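/- Let $r\ge 1$ and let $\lambda=(\lambda_0,\dots,\lambda_l)$ be integers with $0<\lambda_0<\lambda_1<\dots<\lambda_l=r$. An $r$-permutation of $[n]$ is a rearrangement $a_1\cdots a_{rn}$ of the multiset $\{1^r,\dots,n^r\}$ such that $i<j<k$ and $a_i=a_k$ imply $a_j\le a_i$. For a word $w$ with largest letter $m$ write $w=\alpha_0m\alpha_1m\cdots m\alpha_s$ with no $m$ in the $\alpha_j$, and define recursively $S(\emptyset)=S_\lambda(\emptyset)=\emptyset$, $S(w)=S(\alpha_0)\cdots S(\alpha_s)\,m$, and, when $s=r$, $$S_\lambda(w)=S_\lambda(\alpha_0)\cdots S_\lambda(\alpha_{\lambda_0})\,m\,S_\lambda(\alpha_{\lambda_0+1})\cdots S_\lambda(\alpha_{\lambda_1})\,m\cdots m\,S_\lambda(\alpha_{\lambda_{l-1}+1})\cdots S_\lambda(\alpha_{\lambda_l})\,m .$$ A $k$-tuple $r$-permutation of $[n]$ is a tuple of words $(\alpha_1,\dots,\alpha_k)$ whose concatenation is an $r$-permutation of $[n]$ and such that no letter appears in two different components; it is two-stack-sortable (under $S\circ S_\lambda$) if $S(S_\lambda(\alpha_1)\cdots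 S_\lambda(\alpha_k))=12\cdots n$. A letter $a$ of a word is a type $i$ descent ($1\le i\le r$) if its $i$th occurrence is immediately followed by a smaller letter, and a type $0$ descent if its first occurrence immediately follows a smaller letter; the set of type $i$ descents of a tuple is the union of those of its components. The weight of a tuple is $\prod_{i=0}^r x_i^{d_i}$, where $d_i$ is its number of type $i$ descents. Let $g_n^{(k)}\in\mathbb Q[x_0,\dots,x_r]$ be the sum of the weights of the two-stack-sortable $k$-tuple $r$-permutations of $[n]$ with all components nonempty. Put $x^{(0)}=(x_0,\dots,x_{\lambda_0})$, $x^{(i)}=(x_{\lambda_{i-1}+1},\dots,x_{\lambda_i})$ for $1\le i\le l$, and, with $e_j$ the elementary symmetric polynomials, $$f_{n,i}^{(k)}=\sum_{j\ge 0}g_n^{(k+j)}e_j(x^{(i)}),\quad f_{k,i}=\sum_{n\ge0}f_{n,i}^{(k)}u^n,\quad F_i=\sum_{k\ge0}f_{k,i}z^k,\quad g_k=\sum_{n\ge0}g_n^{(k)}u^n,\quad G=\sum_{k\ge0}g_kz^k .$$ Let $x=u\prod_{i=1}^l f_{0,i}$, $E(y,v)=\prod_{i=0}^{\lambda_0}(1+y_iv)$,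 $E(y)=E(y,1)$, and let $c(t)=\frac{1-\sqrt{1-4t}}{2t}$ be the generating function of the Catalan numbers. Then there is exactly one tuple $y=(y_0,\dots,y_{\lambda_0})$ of power series in $u$ over $\mathbb Q[x_0,\dots,x_r]$, with $E(y)$ invertible, such that $$x\,x_i=\frac{y_i(1+y_i)}{E(y)^2}\qquad(0\le i\le\lambda_0),$$ and for this $y$ and $t=zxE(y)^2$ (where $t\neq0$, and $c(t)$ and $E(y,c(t))$ are invertible power series in $z$), $$G=\frac{c(t)E(y)}{E(y,c(t))},\qquad F_0=\frac{E(y)}{t}\left(E(y)-\frac{E(y,c(t))}{c(t)}\right).$$ In particular, every $g_k$ $(k\ge0)$ is algebraic over the field of rational functions $\mathbb Q(u,x_0,\dots,x_r)$. -/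

import Mathlib

open scoped PowerSeries

namespace StackSort

/-! ### The sorting operations on words -/

/-- Splitting a word at one of its own letters gives strictly shorter words. -/
theorem length_lt_of_mem_splitOn {m : ℕ} {w p : List ℕ} (hm : m ∈ w) (hp : p ∈ w.splitOn m) :
    p.length < w.length := by
  have key : ∀ (w : List ℕ), ∀ p ∈ w.splitOn m, p.length ≤ w.length ∧
      (m ∈ w → p.length < w.length) := by
    intro w
    induction w with
    | nil => simp
    | cons a w ih =>
      intro p hp
      rw [List.splitOn_eq_splitOnP, List.splitOnP_cons_eq_if_modifyHead,
        ← List.splitOn_eq_splitOnP] at hp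
      by_cases ha : a = m
      · simp only [ha, beq_self_eq_true, if_true, List.mem_cons] at hp
        rcases hp with rfl | hp
        · simp
        · have := (ih p hp).1
          simp only [List.length_cons]
          omega
      · have ha' : (a == m) = false := by simpa using ha
        simp only [ha'] at hp
        obtain ⟨q, qs, hq⟩ := List.exists_cons_of_ne_nil (List.splitOn_ne_nil m w)
        rw [hq] at hp ih
        simp only [Bool.false_eq_true, if_false, List.modifyHead_cons, List.mem_cons] at hp
        have hmem : m ∈ a :: w → m ∈ w := by
          intro h
          rcases List.mem_cons.1 h with h | h
          · exact absurd h.symm ha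
          · exact h
        rcases hp with rfl | hp
        · have h1 := ih q (by simp)
          refine ⟨by simpa using h1.1, fun h => by simpa using h1.2 (hmem h)⟩
        · have h1 := ih p (by simp [hp])
          refine ⟨?_, fun h => ?_⟩
          · simp only [List.length_cons]; omega
          · have := h1.2 (hmem h)
            simp only [List.length_cons]; omega
  exact (key w p hp).2 hm

/-- The stack-sorting operation `S` on words: if `m` is the largest letter of `w` and
`w = α₁ m α₂ m ⋯ m αₛ` with `m` in none of the `αᵢ`, then `S(w) = S(α₁) S(α₂) ⋯ S(αₛ) m`.
Here `w.splitOn m` is the list `[α₁, …, αₛ]`. -/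
def sort (w : List ℕ) : List ℕ :=
  if h : w = [] then []
  else ((w.splitOn (w.max h)).attach.map fun p => sort p.1).flatten ++ [w.max h]
termination_by w.length
decreasing_by exact length_lt_of_mem_splitOn (List.max_mem h) p.2

/-- The generalized stack-sorting operation `S_λ` for `λ = (lam 0, …, lam l)`: if `m` is the
largest letter of `w` and `w = α₀ m α₁ m ⋯ m αᵣ` with `m` in none of the `αⱼ`, then
`S_λ(w)` is the concatenation of `S_λ(α₀), …, S_λ(αᵣ)` in this order, with one letter `m`
inserted immediately after each of `S_λ(α_{lam 0}), …, S_λ(α_{lam l})`. -/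
def sortLam {l : ℕ} (lam : Fin (l + 1) → ℕ) (w : List ℕ) : List ℕ :=
  if h : w = [] then []
  else ((w.splitOn (w.max h)).attach.mapIdx fun j p =>
    sortLam lam p.1 ++ if ∃ i, lam i = j then [w.max h] else []).flatten
termination_by w.length
decreasing_by exact length_lt_of_mem_splitOn (List.max_mem h) p.2

/-! ### `r`-permutations, tuples, descents -/

/-- `w` is an `r`-permutation of `[n]`: a rearrangement of `1ʳ 2ʳ ⋯ nʳ` such that every letter
standing between two equal letters `a` is at most `a`. -/
def IsRPerm (r n : ℕ) (w : List ℕ) : Prop :=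
  w.Perm ((List.range' 1 n).flatMap fun a => List.replicate r a) ∧
  ∀ i j k : Fin w.length, i < j → j < k → w.get i = w.get k → w.get j ≤ w.get i

/-- `(α₁, …, α_k)` is a `k`-tuple `r`-permutation of `[n]`: the concatenation is an
`r`-permutation of `[n]` and no letter appears in two different components. -/
def IsTuple (r n : ℕ) {k : ℕ} (α : Fin k → List ℕ) : Prop :=
  IsRPerm r n (List.ofFn α).flatten ∧ ∀ i j, i ≠ j → List.Disjoint (α i) (α j)

/-- Two-stack-sortability of a tuple on the letters `1, …, n` with respect to `S ∘ S_λ`: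
`S(S_λ(α₁) ⋯ S_λ(α_k)) = 1 2 ⋯ n`. -/
def IsTwoStackSortable (n : ℕ) {l : ℕ} (lam : Fin (l + 1) → ℕ) {k : ℕ}
    (α : Fin k → List ℕ) : Prop :=
  sort (List.ofFn fun j => sortLam lam (α j)).flatten = List.range' 1 n

/-- The two-stack-sortable `k`-tuple `r`-permutations of `[n]` all of whose components are
nonempty. -/
def sortableTuples (r : ℕ) {l : ℕ} (lam : Fin (l + 1) → ℕ) (n k : ℕ) :
    Set (Fin k → List ℕ) :=
  {α | IsTuple r n α ∧ IsTwoStackSortable n lam α ∧ ∀ j, α j ≠ []}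

theorem finite_sortableTuples (r : ℕ) {l : ℕ} (lam : Fin (l + 1) → ℕ) (n k : ℕ) :
    (sortableTuples r lam n k).Finite := by
  classical
  set L := (List.range' 1 n).flatMap fun a => List.replicate r a
  have hT : {p : List ℕ | ∃ w ∈ L.permutations, p ∈ w.sublists}.Finite := by
    refine (L.permutations.flatMap fun w => w.sublists).toFinset.finite_toSet.subset ?_
    rintro p ⟨w, hw, hp⟩
    simp only [List.coe_toFinset, Set.mem_ofPred_eq, List.mem_flatMap]
    exact ⟨w, hw, hp⟩
  refine (Set.Finite.pi' fun _ : Fin k => hT).subset ?_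
  intro α hα j
  refine ⟨(List.ofFn α).flatten, List.mem_permutations.2 hα.1.1.1, List.mem_sublists.2 ?_⟩
  exact List.sublist_flatten_of_mem (List.mem_ofFn.2 ⟨j, rfl⟩)

/-- The letter `a` is a type `i` descent of `w`. For `i = 0`: the first occurrence of `a`
immediately follows a smaller letter. For `i ≥ 1`: the `i`-th occurrence of `a` is immediately
followed by a smaller letter. -/
def IsDescent (w : List ℕ) : ℕ → ℕ → Prop
  | 0, a => ∃ u b v, w = u ++ b :: a :: v ∧ a ∉ u ∧ b < a
  | i + 1, a => ∃ u b v, w = u ++ a :: b :: v ∧ u.count a = i ∧ b < a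

open Classical in
/-- The set of type `i` descents of a word. -/
noncomputable def descents (i : ℕ) (w : List ℕ) : Finset ℕ :=
  w.toFinset.filter fun a => IsDescent w i a

/-- The set of type `i` descents of a tuple: the union over the components. -/
noncomputable def tupleDescents (i : ℕ) {k : ℕ} (α : Fin k → List ℕ) : Finset ℕ :=
  Finset.univ.biUnion fun j => descents i (α j)

/-! ### The generating functions -/

/-- The ring of weights `ℚ[x₀, …, xᵣ]`. -/
abbrev Coef (r : ℕ) : Type := MvPolynomial (Fin (r + 1)) ℚ

/-- The weight of a tuple: every type `i` descent is weighted by `xᵢ`. -/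
noncomputable def weight (r : ℕ) {k : ℕ} (α : Fin k → List ℕ) : Coef r :=
  ∏ i : Fin (r + 1), MvPolynomial.X i ^ (tupleDescents (i : ℕ) α).card

/-- `g_n^{(k)}`. -/
noncomputable def gCoeff (r : ℕ) {l : ℕ} (lam : Fin (l + 1) → ℕ) (n k : ℕ) : Coef r :=
  ∑ α ∈ (finite_sortableTuples r lam n k).toFinset, weight r α

/-- The indices of the variables in `x^{(i)}`: `0, …, λ₀` for `i = 0`, and
`λ_{i-1} + 1, …, λ_i` for `i ≥ 1`. -/
def block (r : ℕ) {l : ℕ} (lam : Fin (l + 1) → ℕ) (i : Fin (l + 1)) : Finset (Fin (r + 1)) :=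
  Finset.univ.filter fun m => (m : ℕ) ≤ lam i ∧ ∀ j < i, lam j < (m : ℕ)

/-- The elementary symmetric polynomial `e_j(x^{(i)})`. -/
noncomputable def elemSymm (r : ℕ) {l : ℕ} (lam : Fin (l + 1) → ℕ) (i : Fin (l + 1)) (j : ℕ) :
    Coef r :=
  ∑ T ∈ (block r lam i).powersetCard j, ∏ m ∈ T, MvPolynomial.X m

/-- `f_{n,i}^{(k)} = ∑_j g_n^{(k+j)} e_j(x^{(i)})`, where `j` runs from `0` to the number of
variables in `x^{(i)}`. -/
noncomputable def fCoeff (r : ℕ) {l : ℕ} (lam : Fin (l + 1) → ℕ) (i : Fin (l + 1)) (n k : ℕ) :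
    Coef r :=
  ∑ j ∈ Finset.range ((block r lam i).card + 1), gCoeff r lam n (k + j) * elemSymm r lam i j

/-- `g_k = ∑_n g_n^{(k)} uⁿ`, a power series in `u`. -/
noncomputable def g (r : ℕ) {l : ℕ} (lam : Fin (l + 1) → ℕ) (k : ℕ) : (Coef r)⟦X⟧ :=
  PowerSeries.mk fun n => gCoeff r lam n k

/-- `f_{k,i} = ∑_n f_{n,i}^{(k)} uⁿ`, a power series in `u`. -/
noncomputable def f (r : ℕ) {l : ℕ} (lam : Fin (l + 1) → ℕ) (k : ℕ) (i : Fin (l + 1)) :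
    (Coef r)⟦X⟧ :=
  PowerSeries.mk fun n => fCoeff r lam i n k

/-- `G = ∑_k g_k zᵏ`, a power series in `z` over the power series in `u`. -/
noncomputable def G (r : ℕ) {l : ℕ} (lam : Fin (l + 1) → ℕ) : (Coef r)⟦X⟧⟦X⟧ :=
  PowerSeries.mk fun k => g r lam k

/-- `F_i = ∑_k f_{k,i} zᵏ`, a power series in `z` over the power series in `u`. -/
noncomputable def F (r : ℕ) {l : ℕ} (lam : Fin (l + 1) → ℕ) (i : Fin (l + 1)) :
    (Coef r)⟦X⟧⟦X⟧ :=
  PowerSeries.mk fun k => f r lam k i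

/-- The substitution `x = u ∏_{i=1}^{l} f_{0,i}`. -/
noncomputable def xSub (r : ℕ) {l : ℕ} (lam : Fin (l + 1) → ℕ) : (Coef r)⟦X⟧ :=
  PowerSeries.X * ∏ i : Fin l, f r lam 0 i.succ

/-! ### The ingredients of the closed forms -/

/-- `E(y, v) = ∏ᵢ (1 + yᵢ v)`. -/
def E {ι R : Type*} [Fintype ι] [CommRing R] (y : ι → R) (v : R) : R :=
  ∏ i, (1 + y i * v)

/-- `y = (y₀, …, y_{λ₀})` satisfies `x xᵢ = yᵢ (1 + yᵢ) / E(y)²` for `0 ≤ i ≤ λ₀`, where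
`E(y) = E(y, 1)` is invertible. -/
def IsSolution (r : ℕ) {l : ℕ} (lam : Fin (l + 1) → ℕ) (y : block r lam 0 → (Coef r)⟦X⟧) : Prop :=
  IsUnit (E y 1) ∧
  ∀ i : block r lam 0, xSub r lam * PowerSeries.C (MvPolynomial.X i.1) * E y 1 ^ 2
    = y i * (1 + y i)

/-- `t = z x E(y)²`. -/
noncomputable def tSub (r : ℕ) {l : ℕ} (lam : Fin (l + 1) → ℕ)
    (y : block r lam 0 → (Coef r)⟦X⟧) : (Coef r)⟦X⟧⟦X⟧ :=
  PowerSeries.X * PowerSeries.C (xSub r lam * E y 1 ^ 2)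

/-- `c(t)` for a power series `t` in `z` without constant term, where `c` is the generating
function of the Catalan numbers. -/
noncomputable def cat {R : Type*} [CommRing R] [Algebra ℚ R] (t : R⟦X⟧) : R⟦X⟧ :=
  PowerSeries.subst t (PowerSeries.map (Nat.castRingHom ℚ) PowerSeries.catalanSeries)

end StackSort

namespace StackSort

/-! ### Words as joins of blocks along their largest letter -/

/-! Let `m` be the largest letter of a tuple of `k` nonempty words, let the component in position
`j` (from `0`) contain it, and let `b₀, …, bᵣ` be the blocks of that component around `m`. Since
`S_λ` writes `m` exactly after the blocks with indices `λ₀, …, λ_l`, the word fed to `S` is a join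
along `m` of `l + 2` words: the image of the first `j` components together with `b₀, …, b_{λ₀}`, the
images of the `l` further groups of blocks, and the image of the remaining `k - 1 - j` components.
`S` sorts these words separately and then writes `m`, so the tuple is sortable iff the groups are
sortable on consecutive intervals of letters (`sortable_join_iff`). Blocks may be empty, and `m` is
a type `i` descent iff `bᵢ` is nonempty; choosing the nonempty blocks produces the elementary
symmetric polynomials (`slotCount_replicate_append`). Hence `G = 1 + z x F₀ G` (`G_eq`), where `F₀`
is the part of `G ∏ (1 + xᵢ / z)` with nonnegative powers of `z` (`coeff_F`).

As `u` divides `x`, this equation is a `u`-adic contraction and has at most one solution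
(`functional_equation_unique`), so it suffices to check the closed form. Put `s = x E(y)²`, `t =
zs`, `h = 1 / c(t)` and `p = 1 - h`. Then `p` and `h` are the roots of `v² - v + t`, and the
equations for `y` say `s (z + xᵢ) = (p + yᵢ)(h + yᵢ)`. Adding to a multiple of `G ∏ (z + xᵢ)` a term
obtained by exchanging `p` and `h` leaves a polynomial in `z` of controlled degree, from which the
coefficients of `F₀` are read off (`closed_form`).

For algebraicity, everything is algebraic over `ℚ[x₀, …, xᵣ][s]`: the `yᵢ` by their quadratic
equations, then all `g_k` and `f_{0,i}`, and finally `u`, since `s = u ∏ f_{0,i} E(y)²`. As `u` is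
transcendental over `ℚ[x₀, …, xᵣ]`, the exchange property lets `u` replace `s` as base. -/

theorem intercalate_cons (m : ℕ) (b : List ℕ) {bs : List (List ℕ)} (h : bs ≠ []) :
    [m].intercalate (b :: bs) = b ++ m :: [m].intercalate bs := by
  rw [List.intercalate_cons_of_ne_nil h]; simp

theorem count_intercalate (m c : ℕ) (bs : List (List ℕ)) :
    ([m].intercalate bs).count c = bs.flatten.count c + if c = m then bs.length - 1 else 0 := by
  induction bs with
  | nil => simp
  | cons b bs ih =>
    by_cases h : bs = []
    · subst h; simp
    · have : 0 < bs.length := List.length_pos_iff.2 h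
      rw [intercalate_cons m b h]
      simp only [List.count_append, List.count_cons, ih, List.flatten_cons, List.length_cons,
        beq_iff_eq]
      by_cases hc : c = m
      · subst hc; simp; omega
      · have hc' : ¬ m = c := fun h => hc h.symm
        simp [hc, hc']

theorem mem_intercalate {m c : ℕ} {bs : List (List ℕ)} :
    c ∈ [m].intercalate bs ↔ (∃ b ∈ bs, c ∈ b) ∨ (c = m ∧ 2 ≤ bs.length) := by
  rw [← List.count_pos_iff, count_intercalate, ← List.mem_flatten, ← List.count_pos_iff]
  split_ifs with h
  · simp only [h, true_and]; omega
  · simp [h]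

theorem intercalate_ne_nil {m : ℕ} {bs : List (List ℕ)} (h : 2 ≤ bs.length) :
    [m].intercalate bs ≠ [] :=
  List.ne_nil_of_mem (mem_intercalate.2 (Or.inr ⟨rfl, h⟩))

theorem max_intercalate {m : ℕ} {bs : List (List ℕ)} (h : 2 ≤ bs.length)
    (hlt : ∀ b ∈ bs, ∀ c ∈ b, c < m) (hne : [m].intercalate bs ≠ []) :
    ([m].intercalate bs).max hne = m := by
  apply le_antisymm
  · have := List.max_mem hne
    rcases mem_intercalate.1 this with ⟨b, hb, hc⟩ | h
    · exact (hlt b hb _ hc).le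
    · exact h.1.le
  · exact List.le_max_of_mem (mem_intercalate.2 (Or.inr ⟨rfl, h⟩))

theorem splitOn_intercalate_of_lt {m : ℕ} {bs : List (List ℕ)} (h : bs ≠ [])
    (hlt : ∀ b ∈ bs, ∀ c ∈ b, c < m) : ([m].intercalate bs).splitOn m = bs :=
  List.splitOn_intercalate m (fun b hb hm => (hlt b hb m hm).false) h

theorem notMem_of_mem_splitOn {m : ℕ} {w b : List ℕ} (hb : b ∈ w.splitOn m) : m ∉ b := by
  induction w generalizing b with
  | nil => simp at hb; simp [hb]
  | cons a w ih =>
    rw [List.splitOn_cons_eq_if_modifyHead] at hb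
    split_ifs at hb with ha
    · rcases List.mem_cons.1 hb with rfl | hb
      · simp
      · exact ih hb
    · obtain ⟨q, qs, hq⟩ := List.exists_cons_of_ne_nil (List.splitOn_ne_nil m w)
      rw [hq] at hb ih
      rcases List.mem_cons.1 hb with rfl | hb
      · have := ih (b := q) (by simp)
        simp only [beq_iff_eq] at ha
        simp [this, Ne.symm ha]
      · exact ih (by simp [hb])

theorem two_le_length_splitOn {m : ℕ} {w : List ℕ} (hm : m ∈ w) : 2 ≤ (w.splitOn m).length := by
  have h := List.intercalate_splitOn (xs := w) m
  rw [← h] at hm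
  rcases mem_intercalate.1 hm with ⟨b, hb, hc⟩ | h
  · exact absurd hc (notMem_of_mem_splitOn hb)
  · exact h.2

theorem lt_of_mem_splitOn {m : ℕ} {w : List ℕ} (hle : ∀ c ∈ w, c ≤ m) :
    ∀ b ∈ w.splitOn m, ∀ c ∈ b, c < m := by
  intro b hb c hc
  refine lt_of_le_of_ne (hle c ?_) ?_
  · rw [← List.intercalate_splitOn (xs := w) m]
    exact mem_intercalate.2 (Or.inl ⟨b, hb, hc⟩)
  · rintro rfl; exact notMem_of_mem_splitOn hb hc

/-- Every nonempty word is the join of its blocks around its maximum. This principle follows the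
recursion of both sorting maps; at least two blocks means that `m` does occur. -/
theorem word_induction {P : List ℕ → Prop} (nil : P [])
    (join : ∀ m bs, 2 ≤ List.length bs → (∀ b ∈ bs, ∀ c ∈ b, c < m) → (∀ b ∈ bs, P b) →
      P ([m].intercalate bs)) (w : List ℕ) : P w := by
  induction hn : w.length using Nat.strong_induction_on generalizing w with
  | _ n ih =>
    by_cases h : w = []
    · subst h; exact nil
    · have hm := List.max_mem h
      have := join (w.max h) (w.splitOn (w.max h)) (two_le_length_splitOn hm)
        (lt_of_mem_splitOn fun c hc => List.le_max_of_mem hc)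
        (fun b hb => ih _ (hn ▸ length_lt_of_mem_splitOn hm hb) b rfl)
      rwa [List.intercalate_splitOn] at this

/-! ### The sorting maps in terms of joins -/

@[simp] theorem sort_nil : sort [] = [] := by rw [sort]; simp

@[simp] theorem sortLam_nil {l : ℕ} (lam : Fin (l + 1) → ℕ) : sortLam lam [] = [] := by
  rw [sortLam]; simp

theorem sort_intercalate {m : ℕ} {bs : List (List ℕ)} (h : 2 ≤ bs.length)
    (hlt : ∀ b ∈ bs, ∀ c ∈ b, c < m) :
    sort ([m].intercalate bs) = (bs.map sort).flatten ++ [m] := by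
  have hb : bs ≠ [] := by rintro rfl; simp at h
  rw [sort, dif_neg (intercalate_ne_nil h), max_intercalate h hlt,
    splitOn_intercalate_of_lt hb hlt]
  simp

theorem sortLam_intercalate {l : ℕ} (lam : Fin (l + 1) → ℕ) {m : ℕ} {bs : List (List ℕ)}
    (h : 2 ≤ bs.length) (hlt : ∀ b ∈ bs, ∀ c ∈ b, c < m) :
    sortLam lam ([m].intercalate bs) = (bs.mapIdx fun j b =>
      sortLam lam b ++ if ∃ i, lam i = j then [m] else []).flatten := by
  have hb : bs ≠ [] := by rintro rfl; simp at h
  rw [sortLam, dif_neg (intercalate_ne_nil h)]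
  have he : ([m].intercalate bs).splitOn (([m].intercalate bs).max (intercalate_ne_nil h)) =
      bs := by
    rw [max_intercalate h hlt, splitOn_intercalate_of_lt hb hlt]
  simp only [max_intercalate h hlt]
  congr 1
  refine List.ext_getElem (by simp [he]) fun i h1 h2 => ?_
  simp [he]

@[simp] theorem mem_sort {w : List ℕ} {c : ℕ} : c ∈ sort w ↔ c ∈ w := by
  induction w using word_induction with
  | nil => simp
  | join m bs h hlt ih =>
    rw [sort_intercalate h hlt, mem_intercalate]
    simp only [List.mem_append, List.mem_flatten, List.mem_map, List.mem_singleton, h, and_true]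
    refine or_congr ⟨?_, ?_⟩ Iff.rfl
    · rintro ⟨_, ⟨b, hb, rfl⟩, hc⟩; exact ⟨b, hb, (ih b hb).1 hc⟩
    · rintro ⟨b, hb, hc⟩; exact ⟨_, ⟨b, hb, rfl⟩, (ih b hb).2 hc⟩

/-- Only one direction holds in general: if `m` splits the word into too few blocks, `S_λ` writes no
`m` at all. -/
theorem mem_of_mem_sortLam {l : ℕ} {lam : Fin (l + 1) → ℕ} {w : List ℕ} {c : ℕ}
    (hc : c ∈ sortLam lam w) : c ∈ w := by
  induction w using word_induction with
  | nil => simp at hc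
  | join m bs h hlt ih =>
    rw [sortLam_intercalate lam h hlt] at hc
    rw [mem_intercalate]
    simp only [List.mem_flatten, List.mem_mapIdx] at hc
    obtain ⟨_, ⟨i, hi, rfl⟩, hc⟩ := hc
    rcases List.mem_append.1 hc with hc | hc
    · exact Or.inl ⟨_, List.getElem_mem hi, ih _ (List.getElem_mem hi) hc⟩
    · split_ifs at hc with hj
      · exact Or.inr ⟨by simpa using hc, h⟩
      · simp at hc

/-! ### The nesting condition -/

/-- No letter standing between two equal letters `a` is larger than `a`. -/
def Nested (w : List ℕ) : Prop := ∀ a b, a < b → ¬ [a, b, a].Sublist w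

/-- The pattern formulation by sublists passes easily to subwords and concatenations, unlike the one
by positions. -/
theorem nested_iff_get {w : List ℕ} :
    Nested w ↔ ∀ i j k : Fin w.length, i < j → j < k → w.get i = w.get k → w.get j ≤ w.get i := by
  constructor
  · intro h i j k hij hjk he
    by_contra hlt
    refine h _ _ (not_le.1 hlt) (List.sublist_iff_exists_fin_orderEmbedding_get_eq.2 ?_)
    have hs : StrictMono (![i, j, k] : Fin 3 → Fin w.length) := by
      rw [Fin.strictMono_iff_lt_succ]
      intro x; fin_cases x
      · exact hij
      · exact hjk
    refine ⟨OrderEmbedding.ofStrictMono _ hs, fun x => ?_⟩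
    have h3 : ∀ x : Fin 3, [w.get i, w.get j, w.get i].get x = w.get (![i, j, k] x) := by
      intro x; fin_cases x
      · rfl
      · rfl
      · exact he
    exact h3 x
  · intro h a b hab hs
    obtain ⟨e, he⟩ := List.sublist_iff_exists_fin_orderEmbedding_get_eq.1 hs
    have h0 : a = w.get (e ⟨0, by simp⟩) := he ⟨0, by simp⟩
    have h1 : b = w.get (e ⟨1, by simp⟩) := he ⟨1, by simp⟩
    have h2 : a = w.get (e ⟨2, by simp⟩) := he ⟨2, by simp⟩
    have := h (e ⟨0, by simp⟩) (e ⟨1, by simp⟩) (e ⟨2, by simp⟩)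
      (e.lt_iff_lt.2 (by simp)) (e.lt_iff_lt.2 (by simp)) (h0 ▸ h2)
    omega

theorem Nested.of_sublist {v w : List ℕ} (hw : Nested w) (h : v.Sublist w) : Nested v :=
  fun a b hab hs => hw a b hab (hs.trans h)

/-- The two outer letters of a pattern `a b a` are equal, so with disjoint words the whole pattern
lies in one of them. -/
theorem nested_append {v w : List ℕ} (hd : v.Disjoint w) :
    Nested (v ++ w) ↔ Nested v ∧ Nested w := by
  refine ⟨fun h => ⟨h.of_sublist (List.sublist_append_left _ _),
    h.of_sublist (List.sublist_append_right _ _)⟩, ?_⟩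
  rintro ⟨hv, hw⟩ a b hab hs
  obtain ⟨l1, l2, he, h1, h2⟩ := List.sublist_append_iff.1 hs
  match l1, he with
  | [], he => simp at he; subst he; exact hw a b hab h2
  | [x], he =>
    simp only [List.singleton_append, List.cons.injEq] at he
    obtain ⟨rfl, rfl⟩ := he
    exact @hd a (h1.subset (by simp)) (h2.subset (by simp))
  | [x, y], he =>
    simp only [List.cons_append, List.nil_append, List.cons.injEq] at he
    obtain ⟨rfl, rfl, rfl⟩ := he
    exact @hd a (h1.subset (by simp)) (h2.subset (by simp))
  | x :: y :: z :: t, he =>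
    simp only [List.cons_append, List.cons.injEq] at he
    obtain ⟨rfl, rfl, rfl, he⟩ := he
    obtain ⟨rfl, rfl⟩ := List.append_eq_nil_iff.1 he.symm
    exact hv a b hab h1

theorem nested_nil : Nested [] := by
  intro a b _ h; simpa using h.length_le

theorem not_mem_pair_of_nested {u v : List ℕ} {a m : ℕ} (h : Nested (u ++ m :: v)) (ha : a < m)
    (hu : a ∈ u) : a ∉ v := by
  intro hv
  refine h a m ha ?_
  have h1 : [a].Sublist u := List.singleton_sublist.2 hu
  have h2 : [a].Sublist v := List.singleton_sublist.2 hv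
  exact h1.append (h2.cons_cons m)

/-- A letter `a < m` on both sides of `m` would give the pattern `a m a`. This is why the blocks
around the largest letter have no common letters and form a tuple again. -/
theorem nested_append_cons {u v : List ℕ} {m : ℕ} (hu : ∀ c ∈ u, c < m) (hv : ∀ c ∈ v, c ≤ m) :
    Nested (u ++ m :: v) ↔ Nested u ∧ Nested v ∧ u.Disjoint v := by
  constructor
  · intro h
    refine ⟨h.of_sublist (List.sublist_append_left _ _), h.of_sublist ?_, ?_⟩
    · exact (List.sublist_cons_self m v).trans (List.sublist_append_right _ _)
    · exact fun a hau hav => not_mem_pair_of_nested h (hu a hau) hau hav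
  · rintro ⟨h1, h2, h3⟩
    refine (nested_append ?_).2 ⟨h1, ?_⟩
    · intro a ha ha'
      rcases List.mem_cons.1 ha' with rfl | ha'
      · exact (hu _ ha).false
      · exact h3 ha ha'
    · intro a b hab hs
      rcases List.sublist_cons_iff.1 hs with hs | ⟨t, ht, hs⟩
      · exact h2 a b hab hs
      · simp only [List.cons.injEq] at ht
        obtain ⟨rfl, rfl⟩ := ht
        have := hv b (hs.subset (by simp))
        omega

/-- The components are nested and have pairwise no common letter. -/
def NestedTuple (L : List (List ℕ)) : Prop := (∀ w ∈ L, Nested w) ∧ L.Pairwise List.Disjoint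

theorem nestedTuple_cons {w : List ℕ} {L : List (List ℕ)} :
    NestedTuple (w :: L) ↔ Nested w ∧ w.Disjoint L.flatten ∧ NestedTuple L := by
  simp only [NestedTuple, List.mem_cons, forall_eq_or_imp, List.pairwise_cons]
  have : (∀ a' ∈ L, w.Disjoint a') ↔ w.Disjoint L.flatten := by
    simp only [List.Disjoint, List.mem_flatten]; grind
  rw [this]; tauto

theorem nestedTuple_append {K L : List (List ℕ)} :
    NestedTuple (K ++ L) ↔ NestedTuple K ∧ NestedTuple L ∧ K.flatten.Disjoint L.flatten := by
  simp only [NestedTuple, List.mem_append, List.pairwise_append]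
  have : (∀ a ∈ K, ∀ b ∈ L, a.Disjoint b) ↔ K.flatten.Disjoint L.flatten := by
    simp only [List.Disjoint, List.mem_flatten]; grind
  rw [this]; grind

theorem nested_flatten_of_pairwise {L : List (List ℕ)} (h : L.Pairwise List.Disjoint) :
    Nested L.flatten ↔ ∀ w ∈ L, Nested w := by
  induction L with
  | nil => simp [nested_nil]
  | cons w L ih =>
    rw [List.pairwise_cons] at h
    have hd : w.Disjoint L.flatten := by
      simp only [List.Disjoint, List.mem_flatten]
      rintro a ha ⟨l, hl, hal⟩; exact h.1 l hl ha hal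
    rw [List.flatten_cons, nested_append hd, ih h.2]; simp

theorem nested_intercalate {m : ℕ} {bs : List (List ℕ)} (hlt : ∀ b ∈ bs, ∀ c ∈ b, c < m) :
    Nested ([m].intercalate bs) ↔ NestedTuple bs := by
  induction bs with
  | nil => simp [nested_nil, NestedTuple]
  | cons b bs ih =>
    by_cases h : bs = []
    · subst h; simp [NestedTuple]
    · have hb : ∀ c ∈ b, c < m := hlt b (by simp)
      have hbs : ∀ b' ∈ bs, ∀ c ∈ b', c < m := fun b' hb' => hlt b' (by simp [hb'])
      rw [intercalate_cons m b h, nested_append_cons hb ?_, ih hbs, nestedTuple_cons]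
      · have : b.Disjoint ([m].intercalate bs) ↔ b.Disjoint bs.flatten := by
          simp only [List.Disjoint, mem_intercalate, List.mem_flatten]
          grind
        rw [this]; tauto
      · intro c hc
        rcases mem_intercalate.1 hc with ⟨b', hb', hc⟩ | hc
        · exact (hbs b' hb' c hc).le
        · exact hc.1.le

/-! ### Sortable tuples on an interval of letters and their decomposition -/

theorem count_flatten_of_mem {L : List (List ℕ)} (h : L.Pairwise List.Disjoint) {b : List ℕ}
    (hb : b ∈ L) {c : ℕ} (hc : c ∈ b) : L.flatten.count c = b.count c := by
  induction L with
  | nil => simp at hb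
  | cons d L ih =>
    rw [List.pairwise_cons] at h
    rw [List.flatten_cons, List.count_append]
    rcases List.mem_cons.1 hb with rfl | hb
    · have : c ∉ L.flatten := by
        rw [List.mem_flatten]; rintro ⟨l, hl, hcl⟩; exact h.1 l hl hc hcl
      rw [List.count_eq_zero.2 this, add_zero]
    · have : c ∉ d := fun hcd => h.1 b hb hcd hc
      rw [List.count_eq_zero.2 this, zero_add, ih h.2 hb]

/-- The concatenation of the images under `S_λ` of the components of a tuple. -/
def sortWords {l : ℕ} (lam : Fin (l + 1) → ℕ) (L : List (List ℕ)) : List ℕ :=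
  (L.map (sortLam lam)).flatten

theorem sortWords_append {l : ℕ} (lam : Fin (l + 1) → ℕ) (K L : List (List ℕ)) :
    sortWords lam (K ++ L) = sortWords lam K ++ sortWords lam L := by
  simp [sortWords]

theorem mem_flatten_of_mem_sortWords {l : ℕ} {lam : Fin (l + 1) → ℕ} {L : List (List ℕ)} {c : ℕ}
    (h : c ∈ sortWords lam L) : c ∈ L.flatten := by
  simp only [sortWords, List.mem_flatten, List.mem_map] at h ⊢
  obtain ⟨_, ⟨b, hb, rfl⟩, hc⟩ := h
  exact ⟨b, hb, mem_of_mem_sortLam hc⟩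

/-- No letter is lost when each occurs `r` times: the largest letter then cuts the word into `r + 1`
blocks, and since `lam (Fin.last l) = r` a copy is written after the last one. -/
theorem mem_sortLam_of_mem {r l : ℕ} {lam : Fin (l + 1) → ℕ} (hlast : lam (Fin.last l) = r)
    {w : List ℕ} (hw : Nested w) (hcount : ∀ c ∈ w, w.count c = r) {c : ℕ}
    (hc : c ∈ w) : c ∈ sortLam lam w := by
  induction w using word_induction with
  | nil => simp at hc
  | join m bs h hlt ih =>
    have hm : m ∉ bs.flatten := by
      rw [List.mem_flatten]; rintro ⟨b, hb, hmb⟩; exact (hlt b hb m hmb).false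
    rw [nested_intercalate hlt] at hw
    rw [sortLam_intercalate lam h hlt, List.mem_flatten]
    rcases mem_intercalate.1 hc with ⟨b, hb, hcb⟩ | ⟨rfl, -⟩
    · obtain ⟨i, hi, rfl⟩ := List.getElem_of_mem hb
      refine ⟨_, List.mem_mapIdx.2 ⟨i, hi, rfl⟩, List.mem_append_left _ ?_⟩
      refine ih _ hb (hw.1 _ hb) (fun d hd => ?_) hcb
      have := hcount d (mem_intercalate.2 (Or.inl ⟨_, hb, hd⟩))
      rw [count_intercalate, if_neg (hlt _ hb d hd).ne, add_zero,
        count_flatten_of_mem hw.2 hb hd] at this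
      exact this
    · have := hcount c hc
      rw [count_intercalate, if_pos rfl, List.count_eq_zero.2 hm] at this
      refine ⟨_, List.mem_mapIdx.2 ⟨r, by omega, rfl⟩, List.mem_append_right _ ?_⟩
      rw [if_pos ⟨_, hlast⟩]; simp

theorem mem_sortWords {r l : ℕ} {lam : Fin (l + 1) → ℕ} (hlast : lam (Fin.last l) = r)
    {L : List (List ℕ)} (hL : NestedTuple L)
    (hcount : ∀ c ∈ L.flatten, L.flatten.count c = r) {c : ℕ} :
    c ∈ sortWords lam L ↔ c ∈ L.flatten := by
  refine ⟨mem_flatten_of_mem_sortWords, fun h => ?_⟩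
  obtain ⟨b, hb, hc⟩ := List.mem_flatten.1 h
  simp only [sortWords, List.mem_flatten, List.mem_map]
  refine ⟨_, ⟨b, hb, rfl⟩, mem_sortLam_of_mem hlast (hL.1 b hb) (fun d hd => ?_) hc⟩
  rw [← count_flatten_of_mem hL.2 hb hd]
  exact hcount d (List.mem_flatten.2 ⟨b, hb, hd⟩)

/-- Two-stack-sortable tuples on the letters `a + 1, …, a + n`, each occurring `r` times. -/
def Sortable (r : ℕ) {l : ℕ} (lam : Fin (l + 1) → ℕ) (a n : ℕ) (L : List (List ℕ)) : Prop :=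
  (∀ c, L.flatten.count c = if a < c ∧ c ≤ a + n then r else 0) ∧ NestedTuple L ∧
    sort (sortWords lam L) = List.range' (a + 1) n

/-- Sequences of two-stack-sortable tuples on consecutive intervals of letters, together making
up `a + 1, …, a + n`. -/
def SortableGroups (r : ℕ) {l : ℕ} (lam : Fin (l + 1) → ℕ) :
    ℕ → ℕ → List (List (List ℕ)) → Prop
  | _, n, [] => n = 0
  | a, n, G :: Gs => ∃ i j, i + j = n ∧ Sortable r lam a i G ∧ SortableGroups r lam (a + i) j Gs

theorem Sortable.mem_iff {r l : ℕ} {lam : Fin (l + 1) → ℕ} {a n : ℕ} {L : List (List ℕ)}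
    (hr : 0 < r) (h : Sortable r lam a n L) {c : ℕ} : c ∈ L.flatten ↔ a < c ∧ c ≤ a + n := by
  rw [← List.count_pos_iff, h.1]; split_ifs with h' <;> simp [h', hr]

/-- The cuts between the intervals need not be given: they are determined by the lengths of the
sorted words of the groups. -/
theorem sortableGroups_iff {r l : ℕ} {lam : Fin (l + 1) → ℕ} (hlast : lam (Fin.last l) = r)
    (hr : 0 < r) {a n : ℕ} {Gs : List (List (List ℕ))} :
    SortableGroups r lam a n Gs ↔
      (∀ c, Gs.flatten.flatten.count c = if a < c ∧ c ≤ a + n then r else 0) ∧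
      NestedTuple Gs.flatten ∧
      (Gs.map fun G => sort (sortWords lam G)).flatten = List.range' (a + 1) n := by
  induction Gs generalizing a n with
  | nil =>
    simp only [SortableGroups]
    constructor
    · rintro rfl
      refine ⟨fun c => ?_, by simp [NestedTuple], by simp⟩
      rw [if_neg (by omega)]; simp
    · rintro ⟨-, -, h⟩; simpa using h.symm
  | cons G Gs ih =>
    simp only [SortableGroups, List.flatten_cons, List.flatten_append, List.count_append,
      nestedTuple_append, List.map_cons]
    constructor
    · rintro ⟨i, j, rfl, h1, h2⟩
      obtain ⟨h3, h4, h5⟩ := ih.1 h2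
      refine ⟨fun c => ?_, ⟨h1.2.1, h4, ?_⟩, ?_⟩
      · rw [h1.1, h3]; split_ifs <;> omega
      · intro c hc hc'
        rw [h1.mem_iff hr] at hc
        rw [← List.count_pos_iff, h3] at hc'
        split_ifs at hc' <;> omega
      · rw [h1.2.2, h5]
        have := List.range'_append_1 (s := a + 1) (m := i) (n := j)
        rw [show a + i + 1 = a + 1 + i by ring, this]
    · rintro ⟨h1, ⟨h2, h3, h4⟩, h5⟩
      -- `S` keeps the set of letters but only one copy of each in the sorted case, so the length of
      -- the sorted word is the number of letters used by the first group.
      obtain ⟨i, hi⟩ : ∃ i, i = (sort (sortWords lam G)).length := ⟨_, rfl⟩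
      have hin : i ≤ n := by
        have := congrArg List.length h5
        simp only [List.length_append, List.length_range'] at this; omega
      obtain ⟨j, rfl⟩ := Nat.exists_eq_add_of_le hin
      rw [← List.range'_append_1] at h5
      obtain ⟨h6, h7⟩ := List.append_inj h5 (by simp [hi])
      have hmemG : ∀ c, c ∈ G.flatten ↔ a < c ∧ c ≤ a + i := by
        intro c
        rw [← mem_sortWords hlast h2 ?_, ← mem_sort, h6, List.mem_range'_1]
        · omega
        · intro c hc
          have h8 := h1 c
          rw [List.count_eq_zero.2 (h4 hc), add_zero] at h8
          have := List.count_pos_iff.2 hc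
          split_ifs at h8 <;> omega
      refine ⟨i, j, rfl, ⟨fun c => ?_, h2, h6⟩, ih.2 ⟨fun c => ?_, h3, ?_⟩⟩
      · have h8 := h1 c
        by_cases hc : c ∈ G.flatten
        · rw [List.count_eq_zero.2 (h4 hc), add_zero] at h8
          rw [h8]; have := (hmemG c).1 hc
          rw [if_pos this, if_pos (by omega)]
        · rw [List.count_eq_zero.2 hc, if_neg (fun h => hc ((hmemG c).2 h))]
      · have h8 := h1 c
        by_cases hc : c ∈ G.flatten
        · rw [List.count_eq_zero.2 (h4 hc)]
          have := (hmemG c).1 hc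
          rw [if_neg (by omega)]
        · rw [List.count_eq_zero.2 hc, zero_add] at h8
          rw [h8]; have := (not_congr (hmemG c)).1 hc
          split_ifs <;> omega
      · rw [h7]; congr 1; ring

/-! ### Joining blocks at the largest letter -/

theorem intercalate_concat (m : ℕ) (Ys : List (List ℕ)) (Z : List ℕ) :
    [m].intercalate (Ys ++ [Z]) = (Ys.map fun Y => Y ++ [m]).flatten ++ Z := by
  induction Ys with
  | nil => simp
  | cons Y Ys ih => rw [List.cons_append, intercalate_cons m Y (by simp), ih]; simp

/-- The offset `o` is the number of blocks already removed from the left. It keeps the indices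
comparable with `lam` while the induction strips off the first group, after which the offset is `lam
0 + 1`. -/
theorem flatten_mapIdx_blocks (s : List ℕ → List ℕ) (m : ℕ) :
    ∀ {l : ℕ} (lam : Fin (l + 1) → ℕ) (_ : StrictMono lam) (o : ℕ) (_ : o ≤ lam 0)
      (Bs : Fin (l + 1) → List (List ℕ)) (_ : (Bs 0).length + o = lam 0 + 1)
      (_ : ∀ i : Fin l, (Bs i.succ).length + lam i.castSucc = lam i.succ),
      ((List.ofFn Bs).flatten.mapIdx fun j b =>
        s b ++ if ∃ i, lam i = j + o then [m] else []).flatten =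
      ((List.ofFn Bs).map fun B => (B.map s).flatten ++ [m]).flatten := by
  have first : ∀ {l : ℕ} (lam : Fin (l + 1) → ℕ) (_ : StrictMono lam) (B : List (List ℕ)) (o : ℕ)
      (_ : o ≤ lam 0) (_ : B.length + o = lam 0 + 1),
      (B.mapIdx fun j b => s b ++ if ∃ i, lam i = j + o then [m] else []).flatten =
        (B.map s).flatten ++ [m] := by
    intro l lam hm B
    induction B with
    | nil => intro o h1 h2; simp at h2; omega
    | cons b B ih =>
      intro o h1 h2
      rw [List.length_cons] at h2
      by_cases hB : B = []
      · subst hB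
        have : ∃ i, lam i = o := ⟨0, by simp at h2; omega⟩
        simp [this]
      · have hB' := List.length_pos_iff.2 hB
        have : ¬ ∃ i, lam i = 0 + o := by
          rintro ⟨i, hi⟩
          have := hm.monotone (Fin.zero_le i)
          omega
        rw [List.mapIdx_cons, List.flatten_cons, if_neg this, List.map_cons, List.flatten_cons,
          List.append_nil, List.append_assoc, ← ih (o + 1) (by omega) (by omega)]
        congr 2
        simp only [add_assoc, add_comm 1]
  intro l
  induction l with
  | zero =>
    intro lam hm o ho Bs h0 _
    simpa using first lam hm (Bs 0) o ho h0
  | succ l ih =>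
    intro lam hm o ho Bs h0 hs
    rw [List.ofFn_succ, List.flatten_cons, List.mapIdx_append, List.flatten_append,
      first lam hm (Bs 0) o ho h0, List.map_cons, List.flatten_cons]
    congr 1
    have hs0 := hs 0
    simp only [Fin.succ_zero_eq_one, Fin.castSucc_zero] at hs0
    have h01 : lam 0 < lam 1 := hm (by simp)
    rw [← ih (fun i => lam i.succ) (hm.comp (Fin.strictMono_succ)) (lam 0 + 1)
      (by simpa using h01) (fun i => Bs i.succ) (by simp; omega) (fun i => by
        have := hs i.succ
        simpa using this)]
    congr 2
    funext j b
    congr 2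
    apply propext
    constructor
    · rintro ⟨i, hi⟩
      induction i using Fin.cases with
      | zero => omega
      | succ i => exact ⟨i, by omega⟩
    · rintro ⟨i, hi⟩; exact ⟨i.succ, by omega⟩

section join

variable {r l : ℕ} {lam : Fin (l + 1) → ℕ}

/-- The copies of `m` written by `S_λ` end the groups of blocks, so the image of `P` merges with the
first group and that of `Q` stands alone after the last `m`. -/
theorem sortWords_join (hmono : StrictMono lam)
    {m : ℕ} {P Q : List (List ℕ)} {Bs : Fin (l + 1) → List (List ℕ)}
    (hlt : ∀ b ∈ (List.ofFn Bs).flatten, ∀ c ∈ b, c < m)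
    (hlen : 2 ≤ (List.ofFn Bs).flatten.length)
    (h0 : (Bs 0).length = lam 0 + 1)
    (hs : ∀ i : Fin l, (Bs i.succ).length + lam i.castSucc = lam i.succ) :
    sortWords lam (P ++ [[m].intercalate (List.ofFn Bs).flatten] ++ Q) =
      [m].intercalate (((P ++ Bs 0) :: (List.ofFn fun i : Fin l => Bs i.succ) ++ [Q]).map
        (sortWords lam)) := by
  have key := flatten_mapIdx_blocks (sortLam lam) m lam hmono 0 (Nat.zero_le _) Bs (by omega) hs
  simp only [add_zero] at key
  rw [sortWords_append, sortWords_append, List.map_append, List.map_singleton, intercalate_concat]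
  congr 1
  conv_lhs => simp only [sortWords, List.map_singleton, List.flatten_singleton]
  rw [sortLam_intercalate lam hlen hlt, key, List.ofFn_succ]
  simp [sortWords, Function.comp_def]

theorem nestedTuple_join {m : ℕ} {P Q bs : List (List ℕ)}
    (hlt : ∀ b ∈ P ++ bs ++ Q, ∀ c ∈ b, c < m) :
    NestedTuple (P ++ [[m].intercalate bs] ++ Q) ↔ NestedTuple (P ++ bs ++ Q) := by
  have hbs : ∀ b ∈ bs, ∀ c ∈ b, c < m := fun b hb => hlt b (by simp [hb])
  have h1 : NestedTuple [[m].intercalate bs] ↔ NestedTuple bs := by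
    rw [← nested_intercalate hbs]; simp [NestedTuple]
  simp only [nestedTuple_append, h1, List.flatten_append]
  have h2 : P.flatten.Disjoint [[m].intercalate bs].flatten ↔ P.flatten.Disjoint bs.flatten := by
    simp only [List.Disjoint, List.flatten_singleton, mem_intercalate, List.mem_flatten]
    grind
  have h3 : (P.flatten ++ [[m].intercalate bs].flatten).Disjoint Q.flatten ↔
      (P.flatten ++ bs.flatten).Disjoint Q.flatten := by
    simp only [List.Disjoint, List.flatten_singleton, List.mem_append, mem_intercalate,
      List.mem_flatten]
    grind
  rw [h2, h3]

/-- `S` cuts the image of `S_λ` at the copies of `m` only, sorts the `l + 2` pieces independently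
and appends one `m`; the target `range'` also ends in `m`, which cancels. -/
theorem sortable_join_iff (hmono : StrictMono lam) (hlast : lam (Fin.last l) = r) (hr : 0 < r)
    {a n : ℕ} {P Q : List (List ℕ)} {Bs : Fin (l + 1) → List (List ℕ)}
    (hlen : (List.ofFn Bs).flatten.length = r + 1)
    (h0 : (Bs 0).length = lam 0 + 1)
    (hs : ∀ i : Fin l, (Bs i.succ).length + lam i.castSucc = lam i.succ) :
    Sortable r lam a (n + 1) (P ++ [[a + n + 1].intercalate (List.ofFn Bs).flatten] ++ Q) ↔
      SortableGroups r lam a n ((P ++ Bs 0) :: (List.ofFn fun i : Fin l => Bs i.succ) ++ [Q]) := by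
  set m := a + n + 1 with hm
  set bs := (List.ofFn Bs).flatten with hbs
  have hflat : ((P ++ Bs 0) :: (List.ofFn fun i : Fin l => Bs i.succ) ++ [Q]).flatten =
      P ++ bs ++ Q := by
    rw [hbs, List.ofFn_succ]; simp
  have hcount : ∀ c, (P ++ [[m].intercalate bs] ++ Q).flatten.count c =
      (P ++ bs ++ Q).flatten.count c + if c = m then r else 0 := by
    intro c
    simp only [List.flatten_append, List.count_append, List.flatten_singleton, count_intercalate,
      hlen]
    simp only [Nat.add_sub_cancel]
    omega
  rw [sortableGroups_iff hlast hr, hflat]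
  have hcounts : (∀ c, (P ++ [[m].intercalate bs] ++ Q).flatten.count c =
      if a < c ∧ c ≤ a + (n + 1) then r else 0) ↔
      ∀ c, (P ++ bs ++ Q).flatten.count c = if a < c ∧ c ≤ a + n then r else 0 := by
    refine forall_congr' fun c => ?_
    rw [hcount]
    split_ifs <;> omega
  rw [Sortable, hcounts]
  refine and_congr_right fun hc => ?_
  have hlt : ∀ b ∈ P ++ bs ++ Q, ∀ c ∈ b, c < m := by
    intro b hb c hcb
    have := List.count_pos_iff.2 (List.mem_flatten.2 ⟨b, hb, hcb⟩)
    rw [hc] at this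
    split_ifs at this <;> omega
  rw [nestedTuple_join hlt]
  refine and_congr_right fun _ => ?_
  have hltG : ∀ b ∈ ((P ++ Bs 0) :: (List.ofFn fun i : Fin l => Bs i.succ) ++ [Q]).map
      (sortWords lam), ∀ c ∈ b, c < m := by
    intro b hb c hcb
    obtain ⟨G, hG, rfl⟩ := List.mem_map.1 hb
    obtain ⟨b', hb', hcb'⟩ := List.mem_flatten.1 (mem_flatten_of_mem_sortWords hcb)
    refine hlt b' ?_ c hcb'
    rw [← hflat]
    exact List.mem_flatten.2 ⟨G, hG, hb'⟩
  rw [sortWords_join hmono (fun b hb => hlt b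
    (List.mem_append_left _ (List.mem_append_right _ hb))) (by rw [← hbs]; omega) h0 hs,
    sort_intercalate (by simp) hltG, List.range'_1_concat, show a + 1 + n = m by omega,
    List.append_left_inj, List.map_map]
  rfl

/-- The component containing the largest letter, and its blocks. -/
theorem Sortable.exists_join (hr : 0 < r) {a n : ℕ} {L : List (List ℕ)}
    (h : Sortable r lam a (n + 1) L) :
    ∃ P bs Q, L = P ++ [[a + n + 1].intercalate bs] ++ Q ∧ bs.length = r + 1 := by
  have hm : a + n + 1 ∈ L.flatten := (h.mem_iff hr).2 (by omega)
  obtain ⟨w, hw, hmw⟩ := List.mem_flatten.1 hm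
  obtain ⟨P, Q, rfl⟩ := List.append_of_mem hw
  refine ⟨P, w.splitOn (a + n + 1), Q, ?_, ?_⟩
  · rw [List.intercalate_splitOn]; simp
  · have h1 := count_flatten_of_mem h.2.1.2 hw hmw
    rw [h.1, if_pos (by omega), ← List.intercalate_splitOn (xs := w) (a + n + 1),
      count_intercalate, if_pos rfl, List.count_eq_zero.2] at h1
    · omega
    · rw [List.mem_flatten]; rintro ⟨b, hb, hmb⟩; exact notMem_of_mem_splitOn hb hmb

end join

/-! ### Descents and weights -/

theorem IsDescent.mem {w : List ℕ} {i c : ℕ} (h : IsDescent w i c) : c ∈ w := by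
  cases i with
  | zero => obtain ⟨u, b, v, rfl, -⟩ := h; simp
  | succ i => obtain ⟨u, b, v, rfl, -⟩ := h; simp

@[simp] theorem mem_descents {w : List ℕ} {i c : ℕ} : c ∈ descents i w ↔ IsDescent w i c := by
  simp only [descents, Finset.mem_filter, List.mem_toFinset, and_iff_right_iff_imp]
  exact IsDescent.mem

/-- A descent of `c < m` is witnessed by `c` and a smaller neighbour, so it never involves `m` and
stays on one side. As `c` does not occur on the other side, its occurrences keep their numbers. -/
theorem isDescent_left {b w : List ℕ} {m c : ℕ} (i : ℕ) (hc : c < m) (hw : c ∉ w) :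
    IsDescent (b ++ m :: w) i c ↔ IsDescent b i c := by
  cases i with
  | zero =>
    constructor
    · rintro ⟨u, e, v, h, hu, he⟩
      rcases List.append_eq_append_iff.1 h with ⟨as, rfl, h'⟩ | ⟨as, rfl, h'⟩
      · rcases as with _ | ⟨x, as⟩ <;>
          simp only [List.nil_append, List.cons_append, List.cons.injEq] at h'
        · obtain ⟨rfl, rfl⟩ := h'; simp at hw
        · obtain ⟨rfl, rfl⟩ := h'; simp at hw
      · rcases as with _ | ⟨x, _ | ⟨y, as⟩⟩ <;>
          simp only [List.nil_append, List.cons_append, List.cons.injEq] at h'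
        · obtain ⟨rfl, rfl⟩ := h'; simp at hw
        · obtain ⟨rfl, rfl, rfl⟩ := h'; omega
        · obtain ⟨rfl, rfl, rfl⟩ := h'; exact ⟨u, _, as, rfl, hu, he⟩
    · rintro ⟨u, e, v, rfl, hu, he⟩
      exact ⟨u, e, v ++ m :: w, by simp, hu, he⟩
  | succ i =>
    constructor
    · rintro ⟨u, d, v, h, hu, hd⟩
      rcases List.append_eq_append_iff.1 h with ⟨as, rfl, h'⟩ | ⟨as, rfl, h'⟩
      · rcases as with _ | ⟨x, as⟩ <;>
          simp only [List.nil_append, List.cons_append, List.cons.injEq] at h'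
        · omega
        · obtain ⟨rfl, rfl⟩ := h'; simp at hw
      · rcases as with _ | ⟨x, _ | ⟨y, as⟩⟩ <;>
          simp only [List.nil_append, List.cons_append, List.cons.injEq] at h'
        · omega
        · omega
        · obtain ⟨rfl, rfl, rfl⟩ := h'; exact ⟨u, _, as, rfl, hu, hd⟩
    · rintro ⟨u, d, v, rfl, hu, hd⟩
      exact ⟨u, d, v ++ m :: w, by simp, hu, hd⟩

theorem isDescent_right {b w : List ℕ} {m c : ℕ} (i : ℕ) (hc : c < m) (hb : c ∉ b) :
    IsDescent (b ++ m :: w) i c ↔ IsDescent w i c := by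
  cases i with
  | zero =>
    constructor
    · rintro ⟨u, e, v, h, hu, he⟩
      rcases List.append_eq_append_iff.1 h with ⟨as, rfl, h'⟩ | ⟨as, rfl, h'⟩
      · rcases as with _ | ⟨x, as⟩ <;>
          simp only [List.nil_append, List.cons_append, List.cons.injEq] at h'
        · omega
        · obtain ⟨rfl, rfl⟩ := h'
          exact ⟨as, e, v, rfl, fun h => hu (by simp [h]), he⟩
      · rcases as with _ | ⟨x, _ | ⟨y, as⟩⟩ <;>
          simp only [List.nil_append, List.cons_append, List.cons.injEq] at h'
        · omega
        · omega
        · obtain ⟨rfl, rfl, rfl⟩ := h'; simp at hb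
    · rintro ⟨u, e, v, rfl, hu, he⟩
      exact ⟨b ++ m :: u, e, v, by simp, by simp [hb, hu, hc.ne], he⟩
  | succ i =>
    constructor
    · rintro ⟨u, d, v, h, hu, hd⟩
      rcases List.append_eq_append_iff.1 h with ⟨as, rfl, h'⟩ | ⟨as, rfl, h'⟩
      · rcases as with _ | ⟨x, as⟩ <;>
          simp only [List.nil_append, List.cons_append, List.cons.injEq] at h'
        · omega
        · obtain ⟨rfl, rfl⟩ := h'
          refine ⟨as, d, v, rfl, ?_, hd⟩
          rwa [List.count_append, List.count_eq_zero.2 hb, List.count_cons_of_ne hc.ne',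
            zero_add] at hu
      · rcases as with _ | ⟨x, as⟩ <;>
          simp only [List.nil_append, List.cons_append, List.cons.injEq] at h'
        · omega
        · obtain ⟨rfl, -⟩ := h'; simp at hb
    · rintro ⟨u, d, v, rfl, hu, hd⟩
      refine ⟨b ++ m :: u, d, v, by simp, ?_, hd⟩
      rwa [List.count_append, List.count_eq_zero.2 hb, List.count_cons_of_ne hc.ne', zero_add]

theorem isDescent_zero_top {b w : List ℕ} {m : ℕ} (hb : ∀ c ∈ b, c < m) :
    IsDescent (b ++ m :: w) 0 m ↔ b ≠ [] := by
  have hm : m ∉ b := fun h => (hb m h).false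
  constructor
  · rintro ⟨u, e, v, h, hu, he⟩ rfl
    rcases u with _ | ⟨x, u⟩ <;>
      simp only [List.nil_append, List.cons_append, List.cons.injEq] at h
    · omega
    · exact hu (by simp [h.1])
  · intro h
    obtain ⟨u, e, rfl⟩ := (List.eq_nil_or_concat b).resolve_left h
    exact ⟨u, e, w, by simp, fun h => hm (by simp [h]), hb e (by simp)⟩

/-- Removing the first block and the first `m` lowers the occurrence number of every later `m` by
one. -/
theorem isDescent_succ_top {b w : List ℕ} {m : ℕ} (i : ℕ) (hm : m ∉ b) :
    IsDescent (b ++ m :: w) (i + 1) m ↔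
      (i = 0 ∧ ∃ d v, w = d :: v ∧ d < m) ∨ ∃ j, i = j + 1 ∧ IsDescent w (j + 1) m := by
  constructor
  · rintro ⟨u, d, v, h, hu, hd⟩
    rcases List.append_eq_append_iff.1 h with ⟨as, rfl, h'⟩ | ⟨as, rfl, h'⟩
    · rcases as with _ | ⟨x, as⟩ <;>
          simp only [List.nil_append, List.cons_append, List.cons.injEq] at h'
      · rw [List.append_nil, List.count_eq_zero.2 hm] at hu
        exact Or.inl ⟨hu.symm, d, v, h'.2, hd⟩
      · obtain ⟨rfl, rfl⟩ := h'
        rw [List.count_append, List.count_eq_zero.2 hm, List.count_cons_self, zero_add] at hu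
        exact Or.inr ⟨_, hu.symm, as, d, v, rfl, rfl, hd⟩
    · rcases as with _ | ⟨x, as⟩ <;>
          simp only [List.nil_append, List.cons_append, List.cons.injEq] at h'
      · rw [List.append_nil] at hm
        rw [List.count_eq_zero.2 hm] at hu
        exact Or.inl ⟨hu.symm, d, v, h'.2.symm, hd⟩
      · obtain ⟨rfl, -⟩ := h'; simp at hm
  · rintro (⟨rfl, d, v, rfl, hd⟩ | ⟨j, rfl, u, d, v, rfl, hu, hd⟩)
    · exact ⟨b, d, v, rfl, List.count_eq_zero.2 hm, hd⟩
    · refine ⟨b ++ m :: u, d, v, by simp, ?_, hd⟩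
      rw [List.count_append, List.count_eq_zero.2 hm, List.count_cons_self, zero_add, hu]

theorem exists_head_lt_iff {m : ℕ} {b : List ℕ} {bs : List (List ℕ)} (hb : ∀ c ∈ b, c < m) :
    (∃ d v, [m].intercalate (b :: bs) = d :: v ∧ d < m) ↔ b ≠ [] := by
  by_cases h : bs = []
  · subst h
    cases b with
    | nil => simp
    | cons c b => simpa using hb c (by simp)
  · rw [intercalate_cons m b h]
    cases b with
    | nil =>
      simp only [List.nil_append, List.cons.injEq, ne_eq, not_true_eq_false, iff_false, not_exists]
      rintro d v ⟨⟨rfl, -⟩, h⟩; omega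
    | cons c b => simpa using hb c (by simp)

/-- The block with index `i ≥ 1` follows the `i`-th occurrence of `m`, and the block with index `0`
precedes the first one. Type `0` thus fits the same rule; indices beyond the last block get the
default `[]` and give no descent. -/
theorem isDescent_intercalate_top {m : ℕ} {bs : List (List ℕ)} (hlen : 2 ≤ bs.length)
    (hlt : ∀ b ∈ bs, ∀ c ∈ b, c < m) (i : ℕ) :
    IsDescent ([m].intercalate bs) i m ↔ bs.getD i [] ≠ [] := by
  induction i generalizing bs with
  | zero =>
    obtain ⟨b, b', bs, rfl⟩ : ∃ b b' bs', bs = b :: b' :: bs' := by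
      match bs, hlen with
      | b :: b' :: bs, _ => exact ⟨b, b', bs, rfl⟩
    rw [intercalate_cons m b (by simp), isDescent_zero_top (hlt b (by simp))]
    simp
  | succ i ih =>
    obtain ⟨b, b', bs, rfl⟩ : ∃ b b' bs', bs = b :: b' :: bs' := by
      match bs, hlen with
      | b :: b' :: bs, _ => exact ⟨b, b', bs, rfl⟩
    have hm : ∀ c ∈ b :: b' :: bs, m ∉ c := fun c hc h => (hlt c hc m h).false
    rw [intercalate_cons m b (by simp), isDescent_succ_top i (hm b (by simp)),
      exists_head_lt_iff (hlt b' (by simp))]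
    cases i with
    | zero => simp
    | succ i =>
      simp only [Nat.add_eq_zero_iff, one_ne_zero, and_false, false_and, Nat.add_right_cancel_iff,
        exists_eq_left', false_or, List.getD_cons_succ]
      by_cases hbs : bs = []
      · subst hbs
        simp only [List.intercalate_singleton, List.getD_nil, ne_eq, not_true_eq_false, iff_false]
        exact fun h => hm b' (by simp) h.mem
      · have := ih (bs := b' :: bs) (by have := List.length_pos_iff.2 hbs; simp; omega)
          (fun c hc => hlt c (by simp only [List.mem_cons] at hc ⊢; tauto))
        rw [this]; simp

theorem card_descents_erase_top {m : ℕ} {bs : List (List ℕ)} (hd : bs.Pairwise List.Disjoint)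
    (hlt : ∀ b ∈ bs, ∀ c ∈ b, c < m) (i : ℕ) :
    ((descents i ([m].intercalate bs)).erase m).card =
      (bs.map fun b => (descents i b).card).sum := by
  induction bs with
  | nil =>
    have : descents i ([] : List ℕ) = ∅ := by
      ext c; simp only [mem_descents, Finset.notMem_empty, iff_false]
      exact fun h => by simpa using h.mem
    simp [this]
  | cons b bs ih =>
    have hb : ∀ c ∈ b, c < m := hlt b (by simp)
    have hbs : ∀ b' ∈ bs, ∀ c ∈ b', c < m := fun b' h => hlt b' (by simp [h])
    by_cases h : bs = []
    · subst h
      rw [List.intercalate_singleton, Finset.erase_eq_of_notMem]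
      · simp
      · rw [mem_descents]; exact fun h => (hb m h.mem).false
    · rw [List.pairwise_cons] at hd
      have hdis : ∀ c ∈ b, c ∉ [m].intercalate bs := by
        intro c hc hc'
        rcases mem_intercalate.1 hc' with ⟨b', hb', hcb'⟩ | ⟨rfl, -⟩
        · exact hd.1 b' hb' hc hcb'
        · exact (hb c hc).false
      rw [List.map_cons, List.sum_cons, ← ih hd.2 hbs, intercalate_cons m b h,
        ← Finset.card_union_of_disjoint]
      · congr 1
        ext c
        simp only [Finset.mem_erase, Finset.mem_union, mem_descents]
        constructor
        · rintro ⟨hcm, hc⟩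
          rcases List.mem_append.1 hc.mem with hcb | hcw
          · exact Or.inl ((isDescent_left i (hb c hcb) (hdis c hcb)).1 hc)
          · have hcw : c ∈ [m].intercalate bs := (List.mem_cons.1 hcw).resolve_left hcm
            have hlt' : c < m := by
              rcases mem_intercalate.1 hcw with ⟨b', hb', hcb'⟩ | ⟨rfl, -⟩
              · exact hbs b' hb' c hcb'
              · exact absurd rfl hcm
            exact Or.inr ⟨hcm, (isDescent_right i hlt' fun hcb => hdis c hcb hcw).1 hc⟩
        · rintro (hc | ⟨hcm, hc⟩)
          · have := hb c hc.mem
            exact ⟨this.ne, (isDescent_left i this (hdis c hc.mem)).2 hc⟩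
          · have hlt' : c < m := by
              rcases mem_intercalate.1 hc.mem with ⟨b', hb', hcb'⟩ | ⟨rfl, -⟩
              · exact hbs b' hb' c hcb'
              · exact absurd rfl hcm
            exact ⟨hcm, (isDescent_right i hlt' fun hcb => hdis c hcb hc.mem).2 hc⟩
      · rw [Finset.disjoint_left]
        intro c hc hc'
        rw [mem_descents] at hc
        rw [Finset.mem_erase, mem_descents] at hc'
        exact hdis c hc.mem hc'.2.mem

theorem card_descents_intercalate {m : ℕ} {bs : List (List ℕ)} (hlen : 2 ≤ bs.length)
    (hd : bs.Pairwise List.Disjoint) (hlt : ∀ b ∈ bs, ∀ c ∈ b, c < m) (i : ℕ) :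
    (descents i ([m].intercalate bs)).card =
      (bs.map fun b => (descents i b).card).sum + if bs.getD i [] = [] then 0 else 1 := by
  rw [← card_descents_erase_top hd hlt]
  by_cases h : bs.getD i [] = []
  · rw [if_pos h, add_zero, Finset.erase_eq_of_notMem]
    rw [mem_descents, isDescent_intercalate_top hlen hlt]
    exact fun h' => h' h
  · rw [if_neg h, Finset.card_erase_add_one]
    rw [mem_descents, isDescent_intercalate_top hlen hlt]
    exact h

/-- The weight of a single word. -/
noncomputable def wordWeight (r : ℕ) (w : List ℕ) : Coef r :=
  ∏ i : Fin (r + 1), MvPolynomial.X i ^ (descents (i : ℕ) w).card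

theorem wordWeight_nil (r : ℕ) : wordWeight r [] = 1 := by
  have : ∀ i, descents i ([] : List ℕ) = ∅ := by
    intro i; ext c; simp only [mem_descents, Finset.notMem_empty, iff_false]
    exact fun h => by simpa using h.mem
  simp [wordWeight, this]

theorem weight_eq_prod (r : ℕ) {k : ℕ} (α : Fin k → List ℕ)
    (h : ∀ i j, i ≠ j → List.Disjoint (α i) (α j)) :
    weight r α = ((List.ofFn α).map (wordWeight r)).prod := by
  have hcard : ∀ i : ℕ, (tupleDescents i α).card = ∑ j, (descents i (α j)).card := by
    intro i
    rw [tupleDescents, Finset.card_biUnion]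
    intro j _ j' _ hj
    refine Finset.disjoint_left.2 fun c hc hc' => ?_
    rw [mem_descents] at hc hc'
    exact h j j' hj hc.mem hc'.mem
  rw [List.map_ofFn, List.prod_ofFn, weight]
  simp only [hcard, wordWeight, Function.comp_apply]
  rw [Finset.prod_comm]
  simp only [Finset.prod_pow_eq_pow_sum]

theorem prod_pow_sum_map {r : ℕ} (bs : List (List ℕ)) :
    ∏ i : Fin (r + 1), (MvPolynomial.X i : Coef r) ^ (bs.map fun b => (descents i b).card).sum =
      (bs.map (wordWeight r)).prod := by
  induction bs with
  | nil => simp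
  | cons b bs ih =>
    simp only [List.map_cons, List.sum_cons, pow_add, Finset.prod_mul_distrib, ih, List.prod_cons]
    rfl

theorem wordWeight_intercalate {r m : ℕ} {bs : List (List ℕ)} (hlen : 2 ≤ bs.length)
    (hd : bs.Pairwise List.Disjoint) (hlt : ∀ b ∈ bs, ∀ c ∈ b, c < m) :
    wordWeight r ([m].intercalate bs) = (bs.map (wordWeight r)).prod *
      ∏ i : Fin (r + 1), if bs.getD i [] = [] then 1 else MvPolynomial.X i := by
  rw [wordWeight, ← prod_pow_sum_map, ← Finset.prod_mul_distrib]
  refine Finset.prod_congr rfl fun i _ => ?_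
  rw [card_descents_intercalate hlen hd hlt, pow_add]
  split_ifs <;> simp

/-! ### Weighted counting of sortable tuples with prescribed slots -/

/-- The weight of a component in a slot: `none` is a slot for nonempty words, `some i` a slot
for possibly empty words in which nonempty words have the weight `xᵢ`. -/
noncomputable def slotWeight (r : ℕ) : Option (Fin (r + 1)) → List ℕ → Coef r
  | none, w => if w = [] then 0 else 1
  | some i, w => if w = [] then 1 else MvPolynomial.X i

/-- The weight of a tuple in a sequence of slots. -/
noncomputable def slotsWeight (r : ℕ) (σ : List (Option (Fin (r + 1)))) (L : List (List ℕ)) :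
    Coef r :=
  (L.map (wordWeight r)).prod * (List.zipWith (slotWeight r) σ L).prod

theorem slotsWeight_append {r : ℕ} {σ τ : List (Option (Fin (r + 1)))} {K L : List (List ℕ)}
    (h : σ.length = K.length) :
    slotsWeight r (σ ++ τ) (K ++ L) = slotsWeight r σ K * slotsWeight r τ L := by
  simp only [slotsWeight, List.map_append, List.prod_append, List.zipWith_append h]
  ring

theorem slotsWeight_flatten {r : ℕ} {σs : List (List (Option (Fin (r + 1))))}
    {Gs : List (List (List ℕ))} (h : Gs.map List.length = σs.map List.length) :
    (List.zipWith (slotsWeight r) σs Gs).prod = slotsWeight r σs.flatten Gs.flatten := by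
  induction σs generalizing Gs with
  | nil =>
    have : Gs = [] := by simpa using h
    subst this; simp [slotsWeight]
  | cons σ σs ih =>
    cases Gs with
    | nil => simp at h
    | cons G Gs =>
      simp only [List.map_cons, List.cons.injEq] at h
      rw [List.zipWith_cons_cons, List.prod_cons, ih h.2, List.flatten_cons, List.flatten_cons,
        slotsWeight_append h.1.symm]

theorem finite_sortable (r : ℕ) {l : ℕ} (lam : Fin (l + 1) → ℕ) (a n k : ℕ) :
    {L : List (List ℕ) | Sortable r lam a n L ∧ L.length = k}.Finite := by
  have hw : {w : List ℕ | w.length ≤ (a + n + 1) * r ∧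
      ∀ c ∈ w, c ∈ Finset.range (a + n + 1)}.Finite := by
    have := (List.finite_length_le (Fin (a + n + 1)) ((a + n + 1) * r)).image (List.map Fin.val)
    refine this.subset ?_
    rintro w ⟨h1, h2⟩
    refine ⟨w.pmap (fun c hc => ⟨c, hc⟩) (fun c hc => Finset.mem_range.1 (h2 c hc)), ?_, ?_⟩
    · simpa using h1
    · simp [List.map_pmap]
  have hk : {L : List (List ℕ) | L.length = k ∧ ∀ w ∈ L, w ∈
      {w : List ℕ | w.length ≤ (a + n + 1) * r ∧
        ∀ c ∈ w, c ∈ Finset.range (a + n + 1)}}.Finite := by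
    have := (Set.Finite.pi' fun _ : Fin k => hw).image List.ofFn
    refine this.subset ?_
    rintro L ⟨rfl, h⟩
    exact ⟨L.get, fun i => h _ (L.get_mem i), List.ofFn_get L⟩
  refine hk.subset ?_
  rintro L ⟨h, hL⟩
  refine ⟨hL, fun w hw => ?_⟩
  have hmem : ∀ c ∈ L.flatten, c ∈ Finset.range (a + n + 1) := by
    intro c hc
    have := List.count_pos_iff.2 hc
    rw [h.1] at this
    rw [Finset.mem_range]
    split_ifs at this <;> omega
  refine ⟨?_, fun c hc => hmem c (List.mem_flatten.2 ⟨w, hw, hc⟩)⟩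
  refine (List.sublist_flatten_of_mem hw).length_le.trans ?_
  have h1 : L.flatten.length = ∑ c ∈ Finset.range (a + n + 1), L.flatten.count c := by
    have := Multiset.sum_count_eq_card (s := Finset.range (a + n + 1))
      (m := (L.flatten : Multiset ℕ))
      (fun c hc => hmem c (by simpa using hc))
    simpa using this.symm
  rw [h1]
  refine (Finset.sum_le_card_nsmul _ _ r fun c _ => ?_).trans (by simp)
  rw [h.1]; split_ifs <;> simp

/-- The two-stack-sortable tuples with `k` components on the letters `a + 1, …, a + n`. -/
noncomputable def sortableFinset (r : ℕ) {l : ℕ} (lam : Fin (l + 1) → ℕ) (a n k : ℕ) :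
    Finset (List (List ℕ)) :=
  (finite_sortable r lam a n k).toFinset

@[simp] theorem mem_sortableFinset {r l : ℕ} {lam : Fin (l + 1) → ℕ} {a n k : ℕ}
    {L : List (List ℕ)} :
    L ∈ sortableFinset r lam a n k ↔ Sortable r lam a n L ∧ L.length = k := by
  simp [sortableFinset]

/-- The weighted number of sortable tuples in given slots. -/
noncomputable def slotCount (r : ℕ) {l : ℕ} (lam : Fin (l + 1) → ℕ) (a n : ℕ)
    (σ : List (Option (Fin (r + 1)))) : Coef r :=
  ∑ L ∈ sortableFinset r lam a n σ.length, slotsWeight r σ L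

/-- The weighted number of sequences of sortable tuples on consecutive intervals in given
slots. -/
noncomputable def groupCount (r : ℕ) {l : ℕ} (lam : Fin (l + 1) → ℕ) :
    ℕ → ℕ → List (List (Option (Fin (r + 1)))) → Coef r
  | _, n, [] => if n = 0 then 1 else 0
  | a, n, σ :: σs => ∑ p ∈ Finset.HasAntidiagonal.antidiagonal n,
      slotCount r lam a p.1 σ * groupCount r lam (a + p.1) p.2 σs

open Classical in
/-- The sequences of sortable tuples on consecutive intervals with given lengths. -/
noncomputable def groupsFinset (r : ℕ) {l : ℕ} (lam : Fin (l + 1) → ℕ) :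
    ℕ → ℕ → List ℕ → Finset (List (List (List ℕ)))
  | _, n, [] => if n = 0 then {[]} else ∅
  | a, n, k :: ks => (Finset.HasAntidiagonal.antidiagonal n).biUnion fun p =>
      (sortableFinset r lam a p.1 k ×ˢ groupsFinset r lam (a + p.1) p.2 ks).image
        fun x => x.1 :: x.2

theorem mem_groupsFinset {r l : ℕ} {lam : Fin (l + 1) → ℕ} {a n : ℕ} {ks : List ℕ}
    {Gs : List (List (List ℕ))} :
    Gs ∈ groupsFinset r lam a n ks ↔ SortableGroups r lam a n Gs ∧ Gs.map List.length = ks := by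
  induction ks generalizing a n Gs with
  | nil =>
    simp only [groupsFinset, List.map_eq_nil_iff]
    split_ifs with h
    · simp only [Finset.mem_singleton]
      constructor
      · rintro rfl; exact ⟨h, rfl⟩
      · exact fun h => h.2
    · simp only [Finset.notMem_empty, false_iff, not_and]
      rintro h1 rfl; exact h h1
  | cons k ks ih =>
    simp only [groupsFinset, Finset.mem_biUnion, Finset.HasAntidiagonal.mem_antidiagonal,
      Finset.mem_image,
      Finset.mem_product, mem_sortableFinset, ih, Prod.exists]
    constructor
    · rintro ⟨i, j, hij, G, Gs', ⟨⟨h1, h2⟩, h3, h4⟩, rfl⟩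
      exact ⟨⟨i, j, hij, h1, h3⟩, by simp [h2, h4]⟩
    · cases Gs with
      | nil => simp
      | cons G Gs =>
        rintro ⟨⟨i, j, hij, h1, h3⟩, h⟩
        simp only [List.map_cons, List.cons.injEq] at h
        exact ⟨i, j, hij, G, Gs, ⟨⟨h1, h.1⟩, h3, h.2⟩, rfl⟩

/-- A tuple determines the length of its interval, which makes the sets of group sequences for
different cuts disjoint. -/
theorem Sortable.eq_of_sortable {r l : ℕ} {lam : Fin (l + 1) → ℕ} {a n n' : ℕ}
    {L : List (List ℕ)} (h : Sortable r lam a n L) (h' : Sortable r lam a n' L) : n = n' := by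
  have := congrArg List.length (h.2.2.symm.trans h'.2.2)
  simpa using this

theorem groupCount_eq_sum {r l : ℕ} {lam : Fin (l + 1) → ℕ} (a n : ℕ)
    (σs : List (List (Option (Fin (r + 1))))) :
    groupCount r lam a n σs = ∑ Gs ∈ groupsFinset r lam a n (σs.map List.length),
      (List.zipWith (slotsWeight r) σs Gs).prod := by
  classical
  induction σs generalizing a n with
  | nil =>
    simp only [groupCount, groupsFinset, List.map_nil]
    split_ifs <;> simp
  | cons σ σs ih =>
    simp only [groupCount, groupsFinset, List.map_cons]
    rw [Finset.sum_biUnion]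
    · refine Finset.sum_congr rfl fun p _ => ?_
      rw [Finset.sum_image]
      · rw [Finset.sum_product, slotCount, ih, Finset.sum_mul_sum]
        simp
      · rintro ⟨G, Gs⟩ _ ⟨G', Gs'⟩ _ h
        simpa using h
    · rintro ⟨i, j⟩ hij ⟨i', j'⟩ hij' hne
      refine Finset.disjoint_left.2 ?_
      simp only [Finset.mem_image, Finset.mem_product, mem_sortableFinset, Prod.exists]
      rintro _ ⟨G, Gs, ⟨⟨h1, -⟩, -⟩, rfl⟩ ⟨G', Gs', ⟨⟨h2, -⟩, -⟩, h⟩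
      simp only [List.cons.injEq] at h
      obtain ⟨rfl, rfl⟩ := h
      have := h1.eq_of_sortable h2
      simp only [Finset.mem_coe, Finset.HasAntidiagonal.mem_antidiagonal] at hij hij'
      exact hne (by simp; omega)

/-! ### The blocks of variables -/

/-- The slots given by a block of variables. -/
def blockSlots (r : ℕ) {l : ℕ} (lam : Fin (l + 1) → ℕ) (i : Fin (l + 1)) :
    List (Option (Fin (r + 1))) :=
  ((List.finRange (r + 1)).filter fun m => m ∈ block r lam i).map some

theorem length_blockSlots (r : ℕ) {l : ℕ} (lam : Fin (l + 1) → ℕ) (i : Fin (l + 1)) :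
    (blockSlots r lam i).length = (block r lam i).card := by
  rw [blockSlots, List.length_map, ← List.toFinset_card_of_nodup]
  · congr 1; ext m; simp
  · exact (List.nodup_finRange _).filter _

theorem card_block_zero {r l : ℕ} {lam : Fin (l + 1) → ℕ} (hle : ∀ i, lam i ≤ r) :
    (block r lam 0).card = lam 0 + 1 := by
  have : (block r lam 0).map Fin.valEmbedding = Finset.range (lam 0 + 1) := by
    ext m
    simp only [block, Finset.mem_map, Finset.mem_filter, Finset.mem_univ, true_and,
      Fin.valEmbedding_apply, Finset.mem_range, Fin.not_lt_zero, false_imp_iff, implies_true,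
      and_true]
    have := hle 0
    exact ⟨by rintro ⟨x, h, rfl⟩; omega, fun h => ⟨⟨m, by omega⟩, by simp; omega, rfl⟩⟩
  rw [← Finset.card_map Fin.valEmbedding, this, Finset.card_range]

theorem card_block_succ {r l : ℕ} {lam : Fin (l + 1) → ℕ} (hmono : StrictMono lam)
    (hle : ∀ i, lam i ≤ r) (i : Fin l) :
    (block r lam i.succ).card + lam i.castSucc = lam i.succ := by
  have : (block r lam i.succ).map Fin.valEmbedding =
      Finset.Ioc (lam i.castSucc) (lam i.succ) := by
    ext m
    simp only [block, Finset.mem_map, Finset.mem_filter, Finset.mem_univ, true_and,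
      Fin.valEmbedding_apply, Finset.mem_Ioc]
    have := hle i.succ
    constructor
    · rintro ⟨x, ⟨h, h'⟩, rfl⟩
      exact ⟨h' _ i.castSucc_lt_succ, h⟩
    · rintro ⟨h, h'⟩
      refine ⟨⟨m, by omega⟩, ⟨h', fun j hj => lt_of_le_of_lt (hmono.monotone ?_) h⟩, rfl⟩
      exact Fin.le_castSucc_iff.2 hj
  rw [← Finset.card_map Fin.valEmbedding, this, Nat.card_Ioc]
  have := hmono i.castSucc_lt_succ
  omega

/-- The blocks of variables cut `0, …, r` into consecutive intervals, so both lists are strictly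
increasing with the same members. -/
theorem flatten_blockSlots {r l : ℕ} {lam : Fin (l + 1) → ℕ} (hlast : lam (Fin.last l) = r) :
    (List.ofFn (blockSlots r lam)).flatten = (List.finRange (r + 1)).map some := by
  have key : (List.ofFn fun i => (List.finRange (r + 1)).filter fun m => m ∈ block r lam i).flatten
      = List.finRange (r + 1) := by
    have hs : (List.ofFn fun i => (List.finRange (r + 1)).filter fun m =>
        m ∈ block r lam i).flatten.Pairwise (· < ·) := by
      rw [List.pairwise_flatten]
      constructor
      · intro L hL
        obtain ⟨i, rfl⟩ := List.mem_ofFn.1 hL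
        exact (List.pairwise_lt_finRange _).filter _
      · rw [List.pairwise_ofFn]
        intro i j hij x hx y hy
        simp only [block, Finset.mem_filter, Finset.mem_univ, true_and, List.mem_filter,
          List.mem_finRange, decide_eq_true_eq] at hx hy
        have := hy.2 i hij
        exact Fin.lt_def.2 (by omega)
    refine List.Perm.eq_of_pairwise (le := (· < ·))
      (fun a b _ _ h1 h2 => absurd (h1.trans h2) (lt_irrefl _)) hs
      (List.pairwise_lt_finRange _) ?_
    rw [List.perm_ext_iff_of_nodup (hs.imp fun h => h.ne) (List.nodup_finRange _)]
    intro m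
    simp only [List.mem_finRange, iff_true, List.mem_flatten]
    -- The block containing `m` is given by the least `i` with `m ≤ lam i`.
    obtain ⟨i, hi, hmin⟩ := WellFounded.has_min (wellFounded_lt (α := Fin (l + 1)))
      {i | (m : ℕ) ≤ lam i} ⟨Fin.last l, by have := m.2; simp only [Set.mem_ofPred_eq]; omega⟩
    refine ⟨_, List.mem_ofFn.2 ⟨i, rfl⟩, ?_⟩
    simp only [block, Finset.mem_filter, Finset.mem_univ, true_and, List.mem_filter,
      List.mem_finRange, decide_eq_true_eq]
    exact ⟨hi, fun j hj => not_le.1 fun h => hmin j h hj⟩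
  conv_rhs => rw [← key, List.map_flatten, List.map_ofFn]
  rfl

theorem slots_finRange {r : ℕ} {bs : List (List ℕ)} (h : bs.length = r + 1) :
    (List.zipWith (slotWeight r) ((List.finRange (r + 1)).map some) bs).prod =
      ∏ i : Fin (r + 1), if bs.getD i [] = [] then 1 else MvPolynomial.X i := by
  have : List.zipWith (slotWeight r) ((List.finRange (r + 1)).map some) bs =
      List.ofFn fun i : Fin (r + 1) => if bs.getD i [] = [] then 1 else MvPolynomial.X i := by
    refine List.ext_getElem (by simp [h]) fun i h1 h2 => ?_
    have : i < bs.length := by simp at h2; omega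
    simp only [List.getElem_zipWith, List.getElem_map, List.getElem_finRange, List.getElem_ofFn,
      slotWeight, List.getD_eq_getElem _ _ this]
    rfl
  rw [this, List.prod_ofFn]

/-! ### The recursion for tuples of nonempty words -/

/-- The slots of the groups into which a tuple of `k` nonempty words, whose component number `j`
contains the largest letter, decomposes. -/
def groupSlots (r : ℕ) {l : ℕ} (lam : Fin (l + 1) → ℕ) (k j : ℕ) :
    List (List (Option (Fin (r + 1)))) :=
  (List.replicate j none ++ blockSlots r lam 0) ::
    (List.ofFn fun i : Fin l => blockSlots r lam i.succ) ++ [List.replicate (k - 1 - j) none]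

/-- Joining the blocks at the positions `j, …, j + r` of a tuple by the letter `m`. -/
noncomputable def joinAt (m r j : ℕ) (M : List (List ℕ)) : List (List ℕ) :=
  M.take j ++ [[m].intercalate ((M.drop j).take (r + 1))] ++ M.drop (j + (r + 1))

theorem joinAt_append {m r : ℕ} {P bs Q : List (List ℕ)} (h : bs.length = r + 1) :
    joinAt m r P.length (P ++ bs ++ Q) = P ++ [[m].intercalate bs] ++ Q := by
  have h1 : (P ++ bs ++ Q).drop (P.length + (r + 1)) = Q := by
    rw [← h, ← List.length_append, List.drop_left]
  rw [joinAt, h1, List.append_assoc P bs Q, List.take_left, List.drop_left, ← h, List.take_left]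

theorem exists_flatten_eq (ks : List ℕ) (M : List (List ℕ)) (h : M.length = ks.sum) :
    ∃ Gs : List (List (List ℕ)), Gs.flatten = M ∧ Gs.map List.length = ks := by
  induction ks generalizing M with
  | nil => exact ⟨[], (List.length_eq_zero_iff.1 h).symm, rfl⟩
  | cons k ks ih =>
    rw [List.sum_cons] at h
    obtain ⟨Gs, h1, h2⟩ := ih (M.drop k) (by rw [List.length_drop]; omega)
    refine ⟨M.take k :: Gs, by rw [List.flatten_cons, h1, List.take_append_drop], ?_⟩
    rw [List.map_cons, h2, List.length_take]; congr 1; omega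

/-- The component containing the largest letter is unique. This gives the injectivity of `joinAt`.
-/
theorem eq_of_append_cons_eq {P P' Q Q' : List (List ℕ)} {w w' : List ℕ} {m : ℕ}
    (hw : m ∈ w) (hw' : m ∈ w') (hP : ∀ b ∈ P, m ∉ b) (hP' : ∀ b ∈ P', m ∉ b)
    (h : P ++ [w] ++ Q = P' ++ [w'] ++ Q') : P = P' ∧ w = w' ∧ Q = Q' := by
  induction P generalizing P' with
  | nil =>
    cases P' with
    | nil => simpa using h
    | cons b P' =>
      simp only [List.nil_append, List.cons_append, List.cons.injEq] at h
      exact absurd (h.1 ▸ hw) (hP' b (by simp))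
  | cons b P ih =>
    cases P' with
    | nil =>
      simp only [List.nil_append, List.cons_append, List.cons.injEq] at h
      exact absurd (h.1 ▸ hw') (hP b (by simp))
    | cons b' P' =>
      simp only [List.cons_append, List.cons.injEq] at h
      obtain ⟨h1, h2, h3⟩ := ih (fun b hb => hP b (by simp [hb])) (P' := P')
        (fun b hb => hP' b (by simp [hb])) h.2
      exact ⟨by rw [h.1, h1], h2, h3⟩

section recursion

variable {r l : ℕ} {lam : Fin (l + 1) → ℕ}

theorem le_last (hmono : StrictMono lam) (hlast : lam (Fin.last l) = r) (i : Fin (l + 1)) :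
    lam i ≤ r := hlast ▸ hmono.monotone (Fin.le_last i)

theorem exists_groups {k j : ℕ} {Gs : List (List (List ℕ))}
    (h : Gs.map List.length = (groupSlots r lam k j).map List.length) :
    ∃ (P : List (List ℕ)) (Bs : Fin (l + 1) → List (List ℕ)) (Q : List (List ℕ)),
      Gs = (P ++ Bs 0) :: (List.ofFn fun i : Fin l => Bs i.succ) ++ [Q] ∧ P.length = j ∧
      (∀ i, (Bs i).length = (blockSlots r lam i).length) ∧ Q.length = k - 1 - j := by
  rw [groupSlots, List.map_append, List.map_eq_append_iff] at h
  obtain ⟨Gs1, Gs2, rfl, h1, h2⟩ := h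
  rw [List.map_cons, List.map_eq_cons_iff] at h1
  obtain ⟨G, Gs1, rfl, hG, h1⟩ := h1
  rw [List.map_cons, List.map_eq_cons_iff] at h2
  obtain ⟨Q, Gs2, rfl, hQ, h2⟩ := h2
  obtain rfl : Gs2 = [] := by simpa using h2
  rw [List.length_append, List.length_replicate] at hG
  have hl : Gs1.length = l := by simpa using congrArg List.length h1
  subst hl
  -- The first group mixes the `j` components on the left with the first `lam 0 + 1` blocks, so it
  -- has to be cut at `j`.
  refine ⟨G.take j, Fin.cons (G.drop j) Gs1.get, Q, ?_, ?_, ?_, by simpa using hQ⟩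
  · simp only [Fin.cons_zero, Fin.cons_succ, List.take_append_drop]
    rw [List.ofFn_get]
  · rw [List.length_take]; omega
  · intro i
    induction i using Fin.cases with
    | zero => simp only [Fin.cons_zero, List.length_drop]; omega
    | succ i =>
      have := List.getElem_of_eq h1 (i := i) (by simp)
      simpa using this

theorem flatten_groups (P : List (List ℕ)) (Bs : Fin (l + 1) → List (List ℕ))
    (Q : List (List ℕ)) :
    ((P ++ Bs 0) :: (List.ofFn fun i : Fin l => Bs i.succ) ++ [Q]).flatten =
      P ++ (List.ofFn Bs).flatten ++ Q := by
  rw [List.ofFn_succ]; simp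

theorem flatten_groupSlots (hlast : lam (Fin.last l) = r) (k j : ℕ) :
    (groupSlots r lam k j).flatten = List.replicate j none ++ (List.finRange (r + 1)).map some ++
      List.replicate (k - 1 - j) none := by
  rw [← flatten_blockSlots hlast, groupSlots, List.ofFn_succ]; simp

theorem length_flatten_of_blocks (hlast : lam (Fin.last l) = r)
    {Bs : Fin (l + 1) → List (List ℕ)} (h : ∀ i, (Bs i).length = (blockSlots r lam i).length) :
    (List.ofFn Bs).flatten.length = r + 1 := by
  have : (List.ofFn (blockSlots r lam)).flatten.length = r + 1 := by
    rw [flatten_blockSlots hlast]; simp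
  rw [← this, List.length_flatten, List.length_flatten, List.map_ofFn, List.map_ofFn]
  congr 2
  funext i; exact h i

theorem SortableGroups.lt {a n : ℕ} {Gs : List (List (List ℕ))} (hlast : lam (Fin.last l) = r)
    (hr : 0 < r) (h : SortableGroups r lam a n Gs) : ∀ b ∈ Gs.flatten, ∀ c ∈ b, c < a + n + 1 := by
  intro b hb c hc
  have := List.count_pos_iff.2 (List.mem_flatten.2 ⟨b, hb, hc⟩)
  rw [((sortableGroups_iff hlast hr).1 h).1] at this
  split_ifs at this <;> omega

/-- The factor `xᵢ` of a nonempty block in slot `some i` is the weight of the type `i` descent which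
`m` gains in the joined word. That word contains `m`, hence is allowed in a slot `none`. -/
theorem slotsWeight_join {m k : ℕ} {P bs Q : List (List ℕ)} (hr : 0 < r)
    (hlast : lam (Fin.last l) = r) (hP : P.length < k)
    (hbs : bs.length = r + 1)
    (hd : bs.Pairwise List.Disjoint) (hlt : ∀ b ∈ bs, ∀ c ∈ b, c < m) :
    slotsWeight r (groupSlots r lam k P.length).flatten (P ++ bs ++ Q) =
      slotsWeight r (List.replicate k none) (P ++ [[m].intercalate bs] ++ Q) := by
  have hk : List.replicate k (none : Option (Fin (r + 1))) =
      List.replicate P.length none ++ [none] ++ List.replicate (k - 1 - P.length) none := by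
    rw [← List.replicate_succ', List.replicate_append_replicate]; congr 1; omega
  rw [hk, flatten_groupSlots hlast, slotsWeight_append (by simp [hbs]),
    slotsWeight_append (by simp), slotsWeight_append (by simp), slotsWeight_append (by simp)]
  congr 2
  rw [slotsWeight, slots_finRange hbs, slotsWeight, List.map_singleton, List.prod_singleton,
    wordWeight_intercalate (by omega) hd hlt]
  simp [slotWeight, intercalate_ne_nil (m := m) (bs := bs) (by omega)]

/-- Weight-preserving bijection: a position `j` and a sequence of sortable groups correspond to the
tuple in which `r + 1` consecutive words of the flattened sequence are joined by the largest letter.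
-/
theorem slotCount_succ (hmono : StrictMono lam) (hlast : lam (Fin.last l) = r) (hr : 0 < r)
    (a n k : ℕ) :
    slotCount r lam a (n + 1) (List.replicate k none) =
      ∑ j ∈ Finset.range k, groupCount r lam a n (groupSlots r lam k j) := by
  have hb0 : (blockSlots r lam 0).length = lam 0 + 1 := by
    rw [length_blockSlots, card_block_zero (le_last hmono hlast)]
  have hbs : ∀ i : Fin l, (blockSlots r lam i.succ).length + lam i.castSucc = lam i.succ := by
    intro i; rw [length_blockSlots, card_block_succ hmono (le_last hmono hlast)]
  simp only [groupCount_eq_sum, slotCount, List.length_replicate]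
  rw [Finset.sum_sigma']
  symm
  refine Finset.sum_bij (fun x _ => joinAt (a + n + 1) r x.1 x.2.flatten) ?_ ?_ ?_ ?_
  · rintro ⟨j, Gs⟩ hx
    simp only [Finset.mem_sigma, Finset.mem_range, mem_groupsFinset] at hx
    obtain ⟨hj, hG, hlen⟩ := hx
    obtain ⟨P, Bs, Q, rfl, rfl, hBs, hQ⟩ := exists_groups hlen
    have hl := length_flatten_of_blocks hlast hBs
    simp only
    rw [flatten_groups, joinAt_append hl, mem_sortableFinset]
    refine ⟨(sortable_join_iff hmono hlast hr hl ((hBs 0).trans hb0) fun i => ?_).2 hG, ?_⟩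
    · rw [hBs, hbs]
    · simp; omega
  · rintro ⟨j, Gs⟩ hx ⟨j', Gs'⟩ hx' h
    simp only [Finset.mem_sigma, Finset.mem_range, mem_groupsFinset] at hx hx'
    obtain ⟨hj, hG, hlen⟩ := hx
    obtain ⟨hj', hG', hlen'⟩ := hx'
    have hlt := hG.lt hlast hr
    have hlt' := hG'.lt hlast hr
    obtain ⟨P, Bs, Q, hGs, rfl, hBs, hQ⟩ := exists_groups hlen
    obtain ⟨P', Bs', Q', hGs', rfl, hBs', hQ'⟩ := exists_groups hlen'
    have hl := length_flatten_of_blocks hlast hBs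
    have hl' := length_flatten_of_blocks hlast hBs'
    have hf := congrArg List.flatten hGs
    have hf' := congrArg List.flatten hGs'
    rw [flatten_groups] at hf hf'
    simp only [hf, hf', joinAt_append hl, joinAt_append hl'] at h
    rw [hf] at hlt
    rw [hf'] at hlt'
    obtain ⟨rfl, hw, rfl⟩ := eq_of_append_cons_eq (m := a + n + 1)
      (mem_intercalate.2 (Or.inr ⟨rfl, by omega⟩)) (mem_intercalate.2 (Or.inr ⟨rfl, by omega⟩))
      (fun b hb hm => (hlt b (by simp [hb]) _ hm).false)
      (fun b hb hm => (hlt' b (by simp [hb]) _ hm).false) h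
    -- Splitting the joined word at the largest letter recovers its blocks.
    have hw := congrArg (fun w => List.splitOn (a + n + 1) w) hw
    rw [splitOn_intercalate_of_lt (List.ne_nil_of_length_pos (by omega)) fun b hb =>
        hlt b (List.mem_append_left _ (List.mem_append_right _ hb)),
      splitOn_intercalate_of_lt (List.ne_nil_of_length_pos (by omega)) fun b hb =>
        hlt' b (List.mem_append_left _ (List.mem_append_right _ hb))] at hw
    rw [← hw] at hf'
    -- The flattened list and the prescribed lengths determine the groups.
    have : Gs = Gs' := List.eq_iff_flatten_eq.2 ⟨hf.trans hf'.symm, hlen.trans hlen'.symm⟩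
    rw [this]
  · intro L hL
    rw [mem_sortableFinset] at hL
    obtain ⟨hL, hk⟩ := hL
    obtain ⟨P, bs, Q, rfl, hbl⟩ := hL.exists_join hr
    simp only [List.length_append, List.length_singleton] at hk
    obtain ⟨Gs, hGf, hlen⟩ := exists_flatten_eq ((groupSlots r lam k P.length).map List.length)
      (P ++ bs ++ Q) (by
        rw [← List.length_flatten, flatten_groupSlots hlast]; simp; omega)
    obtain ⟨P', Bs, Q', rfl, hP, hBs, hQ⟩ := exists_groups hlen
    have hl := length_flatten_of_blocks hlast hBs
    have hGf' := hGf
    rw [flatten_groups] at hGf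
    obtain ⟨h1, rfl⟩ := List.append_inj hGf (by simp only [List.length_append]; omega)
    obtain ⟨rfl, rfl⟩ := List.append_inj h1 hP
    refine ⟨⟨P'.length, (P' ++ Bs 0) :: (List.ofFn fun i : Fin l => Bs i.succ) ++ [Q']⟩, ?_, ?_⟩
    rotate_left
    · simp only [hGf', joinAt_append hl]
    · simp only [Finset.mem_sigma, Finset.mem_range, mem_groupsFinset]
      refine ⟨by omega, (sortable_join_iff hmono hlast hr hl ((hBs 0).trans hb0) fun i => ?_).1 hL,
        hlen⟩
      rw [hBs, hbs]
  · rintro ⟨j, Gs⟩ hx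
    simp only [Finset.mem_sigma, Finset.mem_range, mem_groupsFinset] at hx
    obtain ⟨hj, hG, hlen⟩ := hx
    have hlt := hG.lt hlast hr
    have hnest := ((sortableGroups_iff hlast hr).1 hG).2.1
    simp only
    rw [slotsWeight_flatten hlen]
    obtain ⟨P, Bs, Q, rfl, rfl, hBs, hQ⟩ := exists_groups hlen
    have hl := length_flatten_of_blocks hlast hBs
    rw [flatten_groups] at hlt hnest ⊢
    rw [joinAt_append hl]
    refine slotsWeight_join hr hlast hj hl ?_ fun b hb =>
      hlt b (List.mem_append_left _ (List.mem_append_right _ hb))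
    rw [nestedTuple_append, nestedTuple_append] at hnest
    exact hnest.1.2.1.2

end recursion

/-! ### From slots to the generating functions -/

section series

variable {r l : ℕ} {lam : Fin (l + 1) → ℕ}

theorem sortable_insert_nil {a n : ℕ} {K M : List (List ℕ)} :
    Sortable r lam a n (K ++ [] :: M) ↔ Sortable r lam a n (K ++ M) := by
  have h1 : NestedTuple (K ++ [] :: M) ↔ NestedTuple (K ++ M) := by
    rw [nestedTuple_append, nestedTuple_append, nestedTuple_cons]
    simp [nested_nil]
  have h2 : sortWords lam (K ++ [] :: M) = sortWords lam (K ++ M) := by simp [sortWords]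
  simp only [Sortable, h1, h2, List.flatten_append, List.flatten_cons, List.nil_append]

theorem slotsWeight_cons (s : Option (Fin (r + 1))) (τ : List (Option (Fin (r + 1))))
    (w : List ℕ) (M : List (List ℕ)) :
    slotsWeight r (s :: τ) (w :: M) = wordWeight r w * slotWeight r s w * slotsWeight r τ M := by
  simp only [slotsWeight, List.map_cons, List.prod_cons, List.zipWith_cons_cons]; ring

theorem slotWeight_some (m : Fin (r + 1)) (w : List ℕ) :
    slotWeight r (some m) w =
      (if w = [] then 1 else 0) + MvPolynomial.X m * slotWeight r none w := by
  simp only [slotWeight]; split_ifs <;> simp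

/-- An empty component can be deleted without affecting sortability or weight, and a nonempty one
contributes `xₘ`. -/
theorem slotCount_some (a n : ℕ) (σ τ : List (Option (Fin (r + 1)))) (m : Fin (r + 1)) :
    slotCount r lam a n (σ ++ some m :: τ) = slotCount r lam a n (σ ++ τ) +
      MvPolynomial.X m * slotCount r lam a n (σ ++ none :: τ) := by
  rw [← sub_eq_iff_eq_add]
  simp only [slotCount, List.length_append, List.length_cons]
  rw [Finset.mul_sum, ← Finset.sum_sub_distrib]
  symm
  -- Inserting `[]` at the slot accounts for the tuples with that component empty; all other tuples
  -- cancel in the difference.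
  refine Finset.sum_of_injOn (fun L => L.take σ.length ++ [] :: L.drop σ.length) ?_ ?_ ?_ ?_
  · intro L hL L' hL' h
    simp only [Finset.mem_coe, mem_sortableFinset] at hL hL'
    obtain ⟨h1, h2⟩ := List.append_inj h (by simp [hL.2, hL'.2])
    rw [← List.take_append_drop σ.length L, h1, (List.cons.inj h2).2, List.take_append_drop]
  · intro L hL
    simp only [Finset.mem_coe, mem_sortableFinset] at hL ⊢
    rw [sortable_insert_nil, List.take_append_drop]
    refine ⟨hL.1, ?_⟩
    simp only [List.length_append, List.length_take, List.length_cons, List.length_drop]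
    omega
  · intro L hL hL'
    rw [mem_sortableFinset] at hL
    obtain ⟨K, w, M, rfl, hK⟩ : ∃ K w M, L = K ++ w :: M ∧ K.length = σ.length := by
      refine ⟨L.take σ.length, L[σ.length]'(by omega), L.drop (σ.length + 1), ?_, ?_⟩
      · rw [← List.drop_eq_getElem_cons, List.take_append_drop]
      · rw [List.length_take]; omega
    have hw : w ≠ [] := by
      rintro rfl
      refine hL' ⟨K ++ M, ?_, ?_⟩
      · simp only [Finset.mem_coe, mem_sortableFinset]
        refine ⟨sortable_insert_nil.1 hL.1, ?_⟩
        have := hL.2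
        simp only [List.length_append, List.length_cons] at this ⊢
        omega
      · simp only [← hK, List.take_left, List.drop_left]
    rw [slotsWeight_append hK.symm, slotsWeight_append hK.symm, slotsWeight_cons, slotsWeight_cons,
      slotWeight_some, if_neg hw]
    ring
  · intro L hL
    rw [mem_sortableFinset] at hL
    have hK : σ.length = (L.take σ.length).length := by rw [List.length_take]; omega
    rw [slotsWeight_append hK, slotsWeight_append hK, slotsWeight_cons, slotsWeight_cons,
      slotWeight_some, if_pos rfl, wordWeight_nil]
    conv_lhs => rw [← List.take_append_drop σ.length L, slotsWeight_append hK]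
    ring

/-- `T` is the set of slots filled by nonempty words; the empty words in the other slots disappear.
Grouping by the cardinality of `T` gives the elementary symmetric polynomials. -/
theorem slotCount_replicate_append (a n k : ℕ) {s : List (Fin (r + 1))} (hs : s.Nodup) :
    slotCount r lam a n (List.replicate k none ++ s.map some) =
      ∑ T ∈ s.toFinset.powerset, (∏ m ∈ T, MvPolynomial.X m) *
        slotCount r lam a n (List.replicate (k + T.card) none) := by
  induction s generalizing k with
  | nil => simp
  | cons m s ih =>
    rw [List.nodup_cons] at hs
    have hm : m ∉ s.toFinset := by simpa using hs.1
    rw [List.map_cons, slotCount_some, List.append_cons, ← List.replicate_succ', ih _ hs.2,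
      ih _ hs.2, List.toFinset_cons, Finset.sum_powerset_insert hm, Finset.mul_sum]
    congr 1
    refine Finset.sum_congr rfl fun T hT => ?_
    have hmT : m ∉ T := fun h => hm (Finset.mem_powerset.1 hT h)
    rw [Finset.prod_insert hmT, Finset.card_insert_of_notMem hmT, mul_assoc]
    congr 4; ring

theorem count_flatMap_replicate (n c : ℕ) :
    ((List.range' 1 n).flatMap fun a => List.replicate r a).count c =
      if 0 < c ∧ c ≤ 0 + n then r else 0 := by
  induction n with
  | zero => simp; omega
  | succ n ih =>
    rw [List.range'_1_concat, List.flatMap_append, List.count_append, ih, List.flatMap_singleton,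
      List.count_replicate]
    simp only [beq_iff_eq]
    split_ifs <;> omega

theorem sortable_ofFn_iff {n k : ℕ} {α : Fin k → List ℕ} :
    Sortable r lam 0 n (List.ofFn α) ↔ IsTuple r n α ∧ IsTwoStackSortable n lam α := by
  rw [Sortable, IsTuple, IsTwoStackSortable, IsRPerm, ← nested_iff_get, List.perm_iff_count]
  simp only [count_flatMap_replicate, sortWords, List.map_ofFn, Function.comp_def]
  have h1 : (∀ i j, i ≠ j → (α i).Disjoint (α j)) ↔ (List.ofFn α).Pairwise List.Disjoint := by
    rw [List.pairwise_ofFn]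
    constructor
    · exact fun h i j hij => h i j hij.ne
    · intro h i j hij
      rcases lt_or_gt_of_ne hij with hij | hij
      · exact h hij
      · exact (h hij).symm
  rw [h1, NestedTuple]
  constructor
  · rintro ⟨h2, ⟨h3, h4⟩, h5⟩
    exact ⟨⟨⟨h2, (nested_flatten_of_pairwise h4).2 h3⟩, h4⟩, h5⟩
  · rintro ⟨⟨⟨h2, h3⟩, h4⟩, h5⟩
    exact ⟨h2, ⟨(nested_flatten_of_pairwise h4).1 h3, h4⟩, h5⟩

theorem slotsWeight_replicate_none (L : List (List ℕ)) :
    slotsWeight r (List.replicate L.length none) L =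
      if ∀ w ∈ L, w ≠ [] then (L.map (wordWeight r)).prod else 0 := by
  classical
  induction L with
  | nil => simp [slotsWeight]
  | cons w L ih =>
    rw [List.length_cons, List.replicate_succ, slotsWeight_cons, ih]
    by_cases hw : w = []
    · simp [hw, slotWeight]
    · simp [hw, slotWeight]

theorem gCoeff_eq_slotCount (n k : ℕ) :
    gCoeff r lam n k = slotCount r lam 0 n (List.replicate k none) := by
  rw [gCoeff, slotCount, List.length_replicate]
  refine Finset.sum_of_injOn List.ofFn (List.ofFn_injective.injOn) ?_ ?_ ?_
  · intro α hα
    simp only [sortableTuples, Set.Finite.coe_toFinset, Set.mem_ofPred_eq] at hα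
    simp only [Finset.mem_coe, mem_sortableFinset, List.length_ofFn, and_true]
    exact sortable_ofFn_iff.2 ⟨hα.1, hα.2.1⟩
  · intro L hL hL'
    rw [mem_sortableFinset] at hL
    obtain ⟨hL, rfl⟩ := hL
    rw [slotsWeight_replicate_none, if_neg]
    intro h
    refine hL' ⟨L.get, ?_, List.ofFn_get L⟩
    simp only [sortableTuples, Set.Finite.coe_toFinset, Set.mem_ofPred_eq]
    have := sortable_ofFn_iff.1 ((List.ofFn_get L).symm ▸ hL)
    exact ⟨this.1, this.2, fun j => h _ (L.get_mem j)⟩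
  · intro α hα
    simp only [sortableTuples, Set.Finite.mem_toFinset, Set.mem_ofPred_eq] at hα
    have := slotsWeight_replicate_none (r := r) (List.ofFn α)
    rw [List.length_ofFn] at this
    rw [this, if_pos, weight_eq_prod r α hα.1.2]
    intro w hw
    obtain ⟨j, rfl⟩ := List.mem_ofFn.1 hw
    exact hα.2.2 j

theorem fCoeff_eq_slotCount (i : Fin (l + 1)) (n k : ℕ) :
    fCoeff r lam i n k = slotCount r lam 0 n (List.replicate k none ++ blockSlots r lam i) := by
  have hs : ((List.finRange (r + 1)).filter fun m => m ∈ block r lam i).toFinset =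
      block r lam i := by ext m; simp
  rw [blockSlots, slotCount_replicate_append _ _ _ ((List.nodup_finRange _).filter _), hs,
    Finset.sum_powerset, fCoeff]
  refine Finset.sum_congr rfl fun j _ => ?_
  rw [elemSymm, Finset.mul_sum]
  refine Finset.sum_congr rfl fun T hT => ?_
  rw [(Finset.mem_powersetCard.1 hT).2, gCoeff_eq_slotCount, mul_comm]

theorem slotCount_zero (a k : ℕ) :
    slotCount r lam a 0 (List.replicate k none) = if k = 0 then 1 else 0 := by
  rw [slotCount, List.length_replicate]
  split_ifs with h
  · subst h
    have : sortableFinset r lam a 0 0 = {[]} := by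
      ext L
      simp only [mem_sortableFinset, List.length_eq_zero_iff, Finset.mem_singleton,
        and_iff_right_iff_imp]
      rintro rfl
      refine ⟨fun c => ?_, by simp [NestedTuple], by simp [sortWords]⟩
      rw [if_neg (by omega)]; simp
    rw [this]; simp [slotsWeight]
  · refine Finset.sum_eq_zero fun L hL => ?_
    rw [mem_sortableFinset] at hL
    obtain ⟨hL, rfl⟩ := hL
    rw [slotsWeight_replicate_none, if_neg]
    intro hne
    obtain ⟨w, hw⟩ := List.exists_mem_of_length_pos (Nat.pos_of_ne_zero h)
    obtain ⟨c, hc⟩ := List.exists_mem_of_ne_nil w (hne w hw)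
    have := List.count_pos_iff.2 (List.mem_flatten.2 ⟨w, hw, hc⟩)
    rw [hL.1] at this
    split_ifs at this <;> omega

theorem groupCount_congr {a b n : ℕ} {σs : List (List (Option (Fin (r + 1))))}
    (h : ∀ σ ∈ σs, ∀ i ≤ n, ∀ a b, slotCount r lam a i σ = slotCount r lam b i σ) :
    groupCount r lam a n σs = groupCount r lam b n σs := by
  induction σs generalizing a b n with
  | nil => rfl
  | cons σ σs ih =>
    simp only [groupCount]
    refine Finset.sum_congr rfl fun p hp => ?_
    have hp := Finset.HasAntidiagonal.mem_antidiagonal.1 hp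
    rw [h σ (by simp) p.1 (by omega) a b, ih fun τ hτ i hi => h τ (by simp [hτ]) i (by omega)]

theorem mem_groupSlots {k j : ℕ} {σ : List (Option (Fin (r + 1)))}
    (h : σ ∈ groupSlots r lam k j) :
    ∃ i, ∃ s : List (Fin (r + 1)), s.Nodup ∧ σ = List.replicate i none ++ s.map some := by
  simp only [groupSlots, List.mem_append, List.mem_cons, List.mem_ofFn,
    List.not_mem_nil, or_false] at h
  rcases h with (rfl | ⟨i, rfl⟩) | rfl
  · exact ⟨j, _, (List.nodup_finRange _).filter _, rfl⟩
  · exact ⟨0, _, (List.nodup_finRange _).filter _, rfl⟩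
  · exact ⟨k - 1 - j, [], List.nodup_nil, by simp⟩

/-- The count does not depend on where the interval starts, because the recursion expresses it by
counts for smaller `n`. No relabelling of words is needed. It turns the sums over cuts into products
of power series. -/
theorem slotCount_shift (hmono : StrictMono lam) (hlast : lam (Fin.last l) = r) (hr : 0 < r)
    (n : ℕ) : ∀ k a b : ℕ, slotCount r lam a n (List.replicate k none) =
      slotCount r lam b n (List.replicate k none) := by
  induction n using Nat.strong_induction_on with
  | _ n ih =>
    intro k a b
    cases n with
    | zero => rw [slotCount_zero, slotCount_zero]
    | succ n =>
      rw [slotCount_succ hmono hlast hr, slotCount_succ hmono hlast hr]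
      refine Finset.sum_congr rfl fun j _ => groupCount_congr fun σ hσ i hi a b => ?_
      obtain ⟨i', s, hs, rfl⟩ := mem_groupSlots hσ
      rw [slotCount_replicate_append _ _ _ hs, slotCount_replicate_append _ _ _ hs]
      refine Finset.sum_congr rfl fun T _ => ?_
      rw [ih i (by omega) _ a b]

theorem slotCount_shift' (hmono : StrictMono lam) (hlast : lam (Fin.last l) = r) (hr : 0 < r)
    (n k a b : ℕ) {s : List (Fin (r + 1))} (hs : s.Nodup) :
    slotCount r lam a n (List.replicate k none ++ s.map some) =
      slotCount r lam b n (List.replicate k none ++ s.map some) := by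
  rw [slotCount_replicate_append _ _ _ hs, slotCount_replicate_append _ _ _ hs]
  refine Finset.sum_congr rfl fun T _ => ?_
  rw [slotCount_shift hmono hlast hr n _ a b]

/-- The generating function of tuples in given slots. -/
noncomputable def slotSeries (r : ℕ) {l : ℕ} (lam : Fin (l + 1) → ℕ)
    (σ : List (Option (Fin (r + 1)))) : (Coef r)⟦X⟧ :=
  PowerSeries.mk fun n => slotCount r lam 0 n σ

theorem groupCount_eq_coeff {a n : ℕ} {σs : List (List (Option (Fin (r + 1))))}
    (h : ∀ σ ∈ σs, ∀ i a b, slotCount r lam a i σ = slotCount r lam b i σ) :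
    groupCount r lam a n σs = PowerSeries.coeff n (σs.map (slotSeries r lam)).prod := by
  induction σs generalizing a n with
  | nil => simp [groupCount, PowerSeries.coeff_one]
  | cons σ σs ih =>
    rw [groupCount, List.map_cons, List.prod_cons, PowerSeries.coeff_mul]
    refine Finset.sum_congr rfl fun p _ => ?_
    rw [ih fun τ hτ => h τ (by simp [hτ]), slotSeries, PowerSeries.coeff_mk,
      h σ (by simp) p.1 a 0]

theorem g_eq_slotSeries (k : ℕ) : g r lam k = slotSeries r lam (List.replicate k none) := by
  ext n; simp [g, slotSeries, gCoeff_eq_slotCount]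

theorem f_eq_slotSeries (k : ℕ) (i : Fin (l + 1)) :
    f r lam k i = slotSeries r lam (List.replicate k none ++ blockSlots r lam i) := by
  ext n; simp [f, slotSeries, fCoeff_eq_slotCount]

/-- The decomposition of tuples at the largest letter, for the generating functions `g_k`. -/
theorem g_eq (hmono : StrictMono lam) (hlast : lam (Fin.last l) = r) (hr : 0 < r) (k : ℕ) :
    g r lam k = (if k = 0 then 1 else 0) +
      xSub r lam * ∑ j ∈ Finset.range k, f r lam j 0 * g r lam (k - 1 - j) := by
  have hprod : ∀ j, ((groupSlots r lam k j).map (slotSeries r lam)).prod =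
      f r lam j 0 * (∏ i : Fin l, f r lam 0 i.succ) * g r lam (k - 1 - j) := by
    intro j
    rw [groupSlots, List.map_append, List.prod_append, List.map_cons, List.prod_cons,
      List.map_ofFn, List.prod_ofFn, List.map_singleton, List.prod_singleton, f_eq_slotSeries,
      g_eq_slotSeries]
    simp [f_eq_slotSeries]
  ext1 n
  rw [xSub, mul_assoc, map_add]
  cases n with
  | zero =>
    rw [PowerSeries.coeff_zero_X_mul, g_eq_slotSeries, slotSeries, PowerSeries.coeff_mk,
      slotCount_zero]
    split_ifs <;> simp
  | succ n =>
    have h0 : PowerSeries.coeff (n + 1) (if k = 0 then (1 : (Coef r)⟦X⟧) else 0) = 0 := by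
      split_ifs <;> simp [PowerSeries.coeff_one]
    rw [h0, zero_add, PowerSeries.coeff_succ_X_mul, Finset.mul_sum, map_sum, g_eq_slotSeries,
      slotSeries, PowerSeries.coeff_mk, slotCount_succ hmono hlast hr]
    refine Finset.sum_congr rfl fun j _ => ?_
    have hshift : ∀ σ ∈ groupSlots r lam k j, ∀ i a b,
        slotCount r lam a i σ = slotCount r lam b i σ := by
      intro σ hσ i a b
      obtain ⟨i', s, hs, rfl⟩ := mem_groupSlots hσ
      exact slotCount_shift' hmono hlast hr i i' a b hs
    rw [groupCount_eq_coeff hshift, hprod, mul_comm (f r lam j 0), mul_assoc]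

theorem G_eq (hmono : StrictMono lam) (hlast : lam (Fin.last l) = r) (hr : 0 < r) :
    G r lam = 1 + PowerSeries.X * PowerSeries.C (xSub r lam) * F r lam 0 * G r lam := by
  ext1 k
  rw [map_add, mul_assoc, mul_assoc]
  cases k with
  | zero =>
    rw [PowerSeries.coeff_zero_X_mul, G, PowerSeries.coeff_mk, g_eq hmono hlast hr]
    simp
  | succ k =>
    rw [PowerSeries.coeff_succ_X_mul, PowerSeries.coeff_C_mul, PowerSeries.coeff_mul,
      Finset.Nat.sum_antidiagonal_eq_sum_range_succ
        (fun i j => PowerSeries.coeff i (F r lam 0) * PowerSeries.coeff j (G r lam)), G,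
      PowerSeries.coeff_mk, g_eq hmono hlast hr, PowerSeries.coeff_one]
    simp [F]

theorem f_eq_sum (k : ℕ) (i : Fin (l + 1)) :
    f r lam k i = ∑ j ∈ Finset.range ((block r lam i).card + 1),
      g r lam (k + j) * PowerSeries.C (elemSymm r lam i j) := by
  ext1 n
  simp [f, g, fCoeff]

/-- Without letters only the empty tuple has nonempty components. It follows that `∏ f_{0,i}` and
`x` are nonzero. -/
theorem constantCoeff_f_zero (i : Fin (l + 1)) :
    PowerSeries.constantCoeff (f r lam 0 i) = 1 := by
  rw [f_eq_sum, map_sum, Finset.sum_eq_single 0]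
  · rw [← PowerSeries.coeff_zero_eq_constantCoeff_apply, g_eq_slotSeries, slotSeries]
    simp [elemSymm]
    simpa using slotCount_zero (r := r) (lam := lam) 0 0
  · intro j _ hj
    rw [map_mul, ← PowerSeries.coeff_zero_eq_constantCoeff_apply, g_eq_slotSeries, slotSeries,
      PowerSeries.coeff_mk, slotCount_zero, if_neg (by omega), zero_mul]
  · simp

end series

/-! ### The functional equation and its solution -/

theorem cat_eq {R : Type*} [CommRing R] [Algebra ℚ R] {t : R⟦X⟧}
    (ht : PowerSeries.constantCoeff t = 0) : cat t = 1 + t * cat t ^ 2 := by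
  have hs : PowerSeries.HasSubst t := PowerSeries.HasSubst.of_constantCoeff_zero' ht
  have h := congrArg (PowerSeries.map (Nat.castRingHom ℚ))
    PowerSeries.catalanSeries_sq_mul_X_add_one
  rw [map_add, map_mul, map_pow, PowerSeries.map_X, map_one] at h
  have h2 := congrArg (PowerSeries.substAlgHom (R := ℚ) hs) h
  rw [map_add, map_mul, map_pow, map_one, PowerSeries.substAlgHom_X, PowerSeries.coe_substAlgHom]
    at h2
  rw [cat]
  conv_lhs => rw [← h2]
  ring

theorem constantCoeff_of_catalan_eq {R : Type*} [CommRing R] {t c : R⟦X⟧}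
    (ht : PowerSeries.constantCoeff t = 0) (hc : c = 1 + t * c ^ 2) :
    PowerSeries.constantCoeff c = 1 := by
  rw [hc]; simp [ht]

/-- Reduction modulo `v² = v - sz`, whose roots are `p` and `h`: a product in `h` becomes linear in
`h` with coefficients polynomial in `z`, and exchanging the roots does not change these
coefficients. The degree bounds are what the extraction of `F` needs. -/
theorem exists_prod_eq {R ι : Type*} [CommRing R] (s : R) {p h : R⟦X⟧} (hph : p + h = 1)
    (hmul : p * h = PowerSeries.X * PowerSeries.C s) (y : ι → R) (S : Finset ι) :
    ∃ α β : R⟦X⟧, (∀ k, S.card < k → PowerSeries.coeff k α = 0) ∧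
      (∀ k, S.card ≤ k → PowerSeries.coeff k β = 0) ∧
      ∏ i ∈ S, (p * h + PowerSeries.C (y i) * h) = α + β * h ∧
      ∏ i ∈ S, (p * h + PowerSeries.C (y i) * p) = α + β * p := by
  classical
  induction S using Finset.induction_on with
  | empty =>
    refine ⟨1, 0, fun k hk => ?_, by simp, by simp, by simp⟩
    rw [PowerSeries.coeff_one, if_neg]; rintro rfl; simp at hk
  | insert i S hi ih =>
    obtain ⟨α, β, hα, hβ, h1, h2⟩ := ih
    -- Expand `(ph + yᵢ h)(α + βh)` and replace `h²` by `h - ph`, where `ph = sz`.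
    refine ⟨PowerSeries.X * (PowerSeries.C s * α - PowerSeries.C s * (PowerSeries.C (y i) * β)),
      PowerSeries.C (y i) * α + PowerSeries.X * (PowerSeries.C s * β) + PowerSeries.C (y i) * β,
      ?_, ?_, ?_, ?_⟩
    · intro k hk
      rw [Finset.card_insert_of_notMem hi] at hk
      obtain ⟨k, rfl⟩ := Nat.exists_eq_add_of_lt hk
      rw [PowerSeries.coeff_succ_X_mul, map_sub, PowerSeries.coeff_C_mul, PowerSeries.coeff_C_mul,
        PowerSeries.coeff_C_mul, hα _ (by omega), hβ _ (by omega)]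
      ring
    · intro k hk
      rw [Finset.card_insert_of_notMem hi] at hk
      obtain ⟨k, rfl⟩ := Nat.exists_eq_add_of_lt (Nat.lt_of_succ_le hk)
      rw [map_add, map_add, PowerSeries.coeff_succ_X_mul, PowerSeries.coeff_C_mul,
        PowerSeries.coeff_C_mul, PowerSeries.coeff_C_mul, hα _ (by omega), hβ _ (by omega),
        hβ _ (by omega)]
      ring
    · rw [Finset.prod_insert hi, h1]
      linear_combination (α - PowerSeries.C (y i) * β + β * h) * hmul +
        PowerSeries.C (y i) * β * h * hph
    · rw [Finset.prod_insert hi, h2]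
      linear_combination (α - PowerSeries.C (y i) * β + β * p) * hmul +
        PowerSeries.C (y i) * β * p * hph

section closedForm

variable {R ι : Type*} [CommRing R] [Fintype ι]

theorem constantCoeff_E (y : ι → R) {c : R⟦X⟧} (hc : PowerSeries.constantCoeff c = 1) :
    PowerSeries.constantCoeff (E (fun i => PowerSeries.C (y i)) c) = E y 1 := by
  simp [E, hc]

variable [IsDomain R]

/-- The closed forms for `G` and for the nonnegative part `F` of `G ∏ (1 + xᵢ / z)`. -/
theorem closed_form {x : R} {a y : ι → R} (hx : x ≠ 0) (hE : IsUnit (E y 1))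
    (hy : ∀ i, x * a i * E y 1 ^ 2 = y i * (1 + y i)) {c G F : R⟦X⟧}
    (hc : c = 1 + PowerSeries.X * PowerSeries.C (x * E y 1 ^ 2) * c ^ 2)
    (hG : G * E (fun i => PowerSeries.C (y i)) c = c * PowerSeries.C (E y 1))
    (hF : ∀ k, PowerSeries.coeff k F = PowerSeries.coeff (Fintype.card ι + k)
      (G * ∏ i, (PowerSeries.X + PowerSeries.C (a i)))) :
    PowerSeries.X * PowerSeries.C (x * E y 1 ^ 2) * F * c = PowerSeries.C (E y 1) *
      (PowerSeries.C (E y 1) * c - E (fun i => PowerSeries.C (y i)) c) ∧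
    G = 1 + PowerSeries.X * PowerSeries.C x * F * G := by
  set e := E y 1 with he
  set s := x * e ^ 2 with hs
  set D := E (fun i => PowerSeries.C (y i)) c with hD
  set N := Fintype.card ι with hN
  have hs0 : s ≠ 0 := mul_ne_zero hx (pow_ne_zero _ hE.ne_zero)
  have hc0 : PowerSeries.constantCoeff c = 1 := constantCoeff_of_catalan_eq (by simp) hc
  set p := PowerSeries.X * PowerSeries.C s * c with hp
  set h := 1 - p with hh
  have hch : c * h = 1 := by rw [hh, hp]; linear_combination hc
  have hph : p + h = 1 := by rw [hh]; ring
  have hmul : p * h = PowerSeries.X * PowerSeries.C s := by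
    rw [hp]; linear_combination PowerSeries.X * PowerSeries.C s * hch
  obtain ⟨α, β, hα, hβ, h1, h2⟩ := exists_prod_eq s hph hmul y Finset.univ
  rw [Finset.card_univ] at hα hβ
  -- Factorwise `s (z + aᵢ) = ph + yᵢ + yᵢ² = (p + yᵢ)(h + yᵢ)`, and `h + yᵢ = h (1 + yᵢ c)` since
  -- `ch = 1`.
  have hprod : PowerSeries.C s ^ N * ∏ i, (PowerSeries.X + PowerSeries.C (a i)) =
      D * (α + β * h) := by
    rw [← h1, hD, E, hN, ← Finset.card_univ, ← Finset.prod_const, ← Finset.prod_mul_distrib,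
      ← Finset.prod_mul_distrib]
    refine Finset.prod_congr rfl fun i _ => ?_
    have hyi : PowerSeries.C s * PowerSeries.C (a i) =
        PowerSeries.C (y i) * (1 + PowerSeries.C (y i)) := by
      rw [← map_mul, ← map_one PowerSeries.C, ← map_add, ← map_mul, ← hy i, hs]
      congr 1; ring
    linear_combination hyi - hmul - PowerSeries.C (y i) * p * hch
      - PowerSeries.C (y i) * hph - PowerSeries.C (y i) ^ 2 * hch
  have hA' : (PowerSeries.X * PowerSeries.C s) ^ N * D = α + β * p := by
    rw [← h2, hD, E, hN, ← Finset.card_univ, ← Finset.prod_const, ← Finset.prod_mul_distrib]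
    refine Finset.prod_congr rfl fun i _ => ?_
    rw [hmul, hp]; ring
  -- As `G D = c e` and `zsc = p`, the first summand is `e (pα + zsβ)`; the second is `e (hα +
  -- zsβ)`, its image under exchanging `p` and `h`. As `p + h = 1`, the sum is a polynomial of
  -- degree at most `N` in `z`.
  have key : PowerSeries.X * (PowerSeries.C s ^ (N + 1) *
      (G * ∏ i, (PowerSeries.X + PowerSeries.C (a i)))) +
      PowerSeries.X ^ N * (PowerSeries.C s ^ N * (PowerSeries.C e * (h * D))) =
      PowerSeries.C e * α + PowerSeries.X * (PowerSeries.C (2 * e * s) * β) := by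
    have h3 : PowerSeries.C (2 * e * s) = 2 * PowerSeries.C e * PowerSeries.C s := by
      rw [map_mul, map_mul, map_ofNat]
    rw [h3]
    linear_combination (PowerSeries.X * PowerSeries.C s * G) * hprod +
      PowerSeries.X * PowerSeries.C s * (α + β * h) * hG + PowerSeries.C e * h * hA' +
      PowerSeries.C e * α * hph + 2 * PowerSeries.C e * β * hmul
  have hcoeff : ∀ k, s * PowerSeries.coeff k F +
      PowerSeries.coeff (k + 1) (PowerSeries.C e * (h * D)) = 0 := by
    intro k
    have h3 := congrArg (PowerSeries.coeff (N + k + 1)) key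
    rw [map_add, map_add, PowerSeries.coeff_succ_X_mul, PowerSeries.coeff_succ_X_mul,
      PowerSeries.coeff_C_mul, PowerSeries.coeff_C_mul, hα _ (by omega), hβ _ (by omega),
      ← map_pow, ← map_pow, PowerSeries.coeff_C_mul, ← hF, show N + k + 1 = k + 1 + N by ring,
      PowerSeries.coeff_X_pow_mul, PowerSeries.coeff_C_mul] at h3
    refine mul_left_cancel₀ (pow_ne_zero N hs0) ?_
    linear_combination h3
  -- The vanishing above degree `N` gives all coefficients but the constant one, which agrees
  -- because `hD` has constant term `e`.
  have htF : PowerSeries.X * PowerSeries.C s * F =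
      PowerSeries.C e * (PowerSeries.C e - h * D) := by
    ext k
    cases k with
    | zero =>
      rw [mul_assoc, PowerSeries.coeff_zero_X_mul, PowerSeries.coeff_zero_eq_constantCoeff_apply,
        map_mul, map_sub, map_mul, constantCoeff_E y hc0]
      simp [hh, hp, ← he]
    | succ k =>
      rw [mul_assoc, PowerSeries.coeff_succ_X_mul, PowerSeries.coeff_C_mul, mul_sub, map_sub,
        ← map_mul, PowerSeries.coeff_C, if_neg (Nat.succ_ne_zero k)]
      linear_combination hcoeff k
  refine ⟨?_, ?_⟩
  · rw [htF]
    linear_combination -(PowerSeries.C e * D) * hch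
  · have he0 : PowerSeries.C e ≠ 0 := by
      intro h0
      exact hE.ne_zero (PowerSeries.C_injective (h0.trans (map_zero _).symm))
    refine mul_left_cancel₀ (pow_ne_zero 2 he0) ?_
    have hsC : PowerSeries.C s = PowerSeries.C x * PowerSeries.C e ^ 2 := by
      rw [hs, map_mul, map_pow]
    rw [hsC] at htF
    linear_combination -G * htF + PowerSeries.C e * h * hG + PowerSeries.C e ^ 2 * hch

end closedForm

/-! ### Uniqueness for the functional equation -/

theorem eq_zero_of_X_pow_dvd {K : Type*} [CommRing K] {φ : K⟦X⟧}
    (h : ∀ n, (PowerSeries.X : K⟦X⟧) ^ n ∣ φ) : φ = 0 := by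
  ext n
  exact PowerSeries.X_pow_dvd_iff.1 (h (n + 1)) n (Nat.lt_succ_self n)

theorem dvd_coeff_mul {R : Type*} [CommRing R] {d : R} {φ : R⟦X⟧}
    (h : ∀ k, d ∣ PowerSeries.coeff k φ) (ψ : R⟦X⟧) (k : ℕ) : d ∣ PowerSeries.coeff k (φ * ψ) := by
  rw [PowerSeries.coeff_mul]
  exact Finset.dvd_sum fun p _ => Dvd.dvd.mul_right (h _) _

/-- The functional equation determines `G` when `u` divides `x`. -/
theorem functional_equation_unique {K : Type*} [CommRing K] {x : K⟦X⟧}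
    (hx : PowerSeries.X ∣ x) {N : ℕ} {P G₁ F₁ G₂ F₂ : K⟦X⟧⟦X⟧}
    (h₁ : G₁ = 1 + PowerSeries.X * PowerSeries.C x * F₁ * G₁)
    (h₂ : G₂ = 1 + PowerSeries.X * PowerSeries.C x * F₂ * G₂)
    (hF₁ : ∀ k, PowerSeries.coeff k F₁ = PowerSeries.coeff (N + k) (G₁ * P))
    (hF₂ : ∀ k, PowerSeries.coeff k F₂ = PowerSeries.coeff (N + k) (G₂ * P)) : G₁ = G₂ := by
  have key : ∀ n k, (PowerSeries.X : K⟦X⟧) ^ n ∣ PowerSeries.coeff k (G₁ - G₂) := by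
    intro n
    induction n with
    | zero => simp
    | succ n ih =>
      have hF : ∀ k, (PowerSeries.X : K⟦X⟧) ^ n ∣ PowerSeries.coeff k (F₁ - F₂) := by
        intro k
        rw [map_sub, hF₁, hF₂, ← map_sub, ← sub_mul]
        exact dvd_coeff_mul ih P _
      -- The factor `x` is divisible by `u`, so each use of the equation raises the known power of
      -- `u` by one.
      have : G₁ - G₂ = PowerSeries.X * (PowerSeries.C x *
          ((G₁ - G₂) * F₁ + (F₁ - F₂) * G₂)) := by
        linear_combination h₁ - h₂
      intro k
      rw [this]
      cases k with
      | zero => simp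
      | succ k =>
        rw [PowerSeries.coeff_succ_X_mul, PowerSeries.coeff_C_mul, pow_succ', map_add]
        exact mul_dvd_mul hx (dvd_add (dvd_coeff_mul ih _ _) (dvd_coeff_mul hF _ _))
  rw [← sub_eq_zero]
  ext1 k
  rw [map_zero]
  exact eq_zero_of_X_pow_dvd fun n => key n k

/-- Multiplying `∏ (1 + xᵢ / z)` by `z^N`, with `N` the number of variables, avoids negative powers:
the nonnegative part becomes the coefficients from index `N` on. -/
theorem coeff_F {r l : ℕ} {lam : Fin (l + 1) → ℕ} (k : ℕ) :
    PowerSeries.coeff k (F r lam 0) = PowerSeries.coeff (Fintype.card (block r lam 0) + k)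
      (G r lam * ∏ i : block r lam 0,
        (PowerSeries.X + PowerSeries.C (PowerSeries.C (MvPolynomial.X i.1)))) := by
  have hcard : Fintype.card (block r lam 0) = (block r lam 0).card := Fintype.card_coe _
  rw [Finset.prod_coe_sort (block r lam 0)
    (fun i => (PowerSeries.X + PowerSeries.C (PowerSeries.C (MvPolynomial.X i)) :
      (Coef r)⟦X⟧⟦X⟧)), hcard]
  have hprod : ∏ i ∈ block r lam 0,
      (PowerSeries.X + PowerSeries.C (PowerSeries.C (MvPolynomial.X i)) : (Coef r)⟦X⟧⟦X⟧) =
      ∑ j ∈ Finset.range ((block r lam 0).card + 1),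
        PowerSeries.C (PowerSeries.C (elemSymm r lam 0 j)) *
          PowerSeries.X ^ ((block r lam 0).card - j) := by
    simp_rw [add_comm (PowerSeries.X : (Coef r)⟦X⟧⟦X⟧)]
    rw [Finset.prod_add, Finset.sum_powerset]
    refine Finset.sum_congr rfl fun j _ => ?_
    rw [elemSymm, map_sum, map_sum, Finset.sum_mul]
    refine Finset.sum_congr rfl fun T hT => ?_
    rw [Finset.mem_powersetCard] at hT
    rw [Finset.prod_const, Finset.card_sdiff_of_subset hT.1, hT.2, map_prod, map_prod]
  rw [hprod, Finset.mul_sum, map_sum, F, PowerSeries.coeff_mk, f_eq_sum]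
  refine Finset.sum_congr rfl fun j hj => ?_
  have hj := Finset.mem_range.1 hj
  rw [mul_left_comm, PowerSeries.coeff_C_mul, PowerSeries.coeff_mul_X_pow', if_pos (by omega), G,
    PowerSeries.coeff_mk, mul_comm]
  congr 2; omega

/-! ### Existence and uniqueness of `y` -/

/-- A contraction of tuples of power series has a fixed point. -/
theorem exists_fixedPoint {K ι : Type*} [CommRing K] (Φ : (ι → K⟦X⟧) → ι → K⟦X⟧)
    (hΦ : ∀ (n : ℕ) (a b : ι → K⟦X⟧), (∀ i, (PowerSeries.X : K⟦X⟧) ^ n ∣ a i - b i) →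
      ∀ i, (PowerSeries.X : K⟦X⟧) ^ (n + 1) ∣ Φ a i - Φ b i) : ∃ Y, Φ Y = Y := by
  set a : ℕ → ι → K⟦X⟧ := fun n => Φ^[n] 0 with ha
  have hsucc : ∀ n, a (n + 1) = Φ (a n) := fun n => Function.iterate_succ_apply' Φ n 0
  have hstep : ∀ n i, (PowerSeries.X : K⟦X⟧) ^ n ∣ a (n + 1) i - a n i := by
    intro n
    induction n with
    | zero => simp
    | succ n ih =>
      rw [hsucc (n + 1), hsucc n]
      rw [hsucc n] at ih
      exact hΦ n _ _ ih
  have hadd : ∀ n d i, (PowerSeries.X : K⟦X⟧) ^ n ∣ a (n + d) i - a n i := by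
    intro n d i
    induction d with
    | zero => simp
    | succ d ih =>
      have := dvd_add (((pow_dvd_pow PowerSeries.X (Nat.le_add_right n d))).trans
        (hstep (n + d) i)) ih
      rwa [sub_add_sub_cancel] at this
  -- The coefficient of index `n` no longer changes from the iterate `a (n + 1)` on.
  set Y : ι → K⟦X⟧ := fun i => PowerSeries.mk fun n => PowerSeries.coeff n (a (n + 1) i) with hY
  have hYa : ∀ n i, (PowerSeries.X : K⟦X⟧) ^ n ∣ Y i - a n i := by
    intro n i
    rw [PowerSeries.X_pow_dvd_iff]
    intro m hm
    obtain ⟨d, rfl⟩ := Nat.exists_eq_add_of_le (Nat.succ_le_of_lt hm)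
    have := PowerSeries.X_pow_dvd_iff.1 (hadd (m + 1) d i) m (Nat.lt_succ_self m)
    rw [map_sub, sub_eq_zero] at this
    rw [map_sub, hY, PowerSeries.coeff_mk, Nat.succ_eq_add_one, this, sub_self]
  refine ⟨Y, funext fun i => sub_eq_zero.1 (eq_zero_of_X_pow_dvd fun n => ?_)⟩
  have h1 := (pow_dvd_pow (PowerSeries.X : K⟦X⟧) (Nat.le_succ n)).trans (hΦ n _ _ (hYa n) i)
  have h2 := (pow_dvd_pow (PowerSeries.X : K⟦X⟧) (Nat.le_succ n)).trans (hYa (n + 1) i)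
  rw [hsucc] at h2
  have := dvd_sub h1 h2
  rwa [sub_sub_sub_cancel_right] at this

theorem dvd_E_sub_E {R ι : Type*} [CommRing R] [Fintype ι] {d : R} {y y' : ι → R}
    (h : ∀ i, d ∣ y i - y' i) (v : R) : d ∣ E y v - E y' v := by
  rw [← Ideal.mem_span_singleton, ← Ideal.Quotient.eq, E, E, map_prod, map_prod]
  refine Finset.prod_congr rfl fun i _ => ?_
  have := Ideal.Quotient.eq.2 (Ideal.mem_span_singleton.2 (h i))
  rw [map_add, map_add, map_mul, map_mul, this]

section solution

variable {K ι : Type*} [CommRing K] [Fintype ι] {x : K⟦X⟧} {a : ι → K⟦X⟧}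

/-- Write `x = u x'` and `y = u Y`. Dividing the equations by `u` gives `Yᵢ = x' aᵢ E(uY)² - u Yᵢ²`,
and the right side is a `u`-adic contraction in `Y`. -/
theorem exists_solution (hx : PowerSeries.X ∣ x) :
    ∃ y : ι → K⟦X⟧, IsUnit (E y 1) ∧ ∀ i, x * a i * E y 1 ^ 2 = y i * (1 + y i) := by
  obtain ⟨x', rfl⟩ := hx
  obtain ⟨Y, hY⟩ := exists_fixedPoint
    (fun (Y : ι → K⟦X⟧) i => x' * a i * E (fun j => PowerSeries.X * Y j) 1 ^ 2 -
      PowerSeries.X * Y i ^ 2) (by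
    intro n b b' h i
    have h1 : (PowerSeries.X : K⟦X⟧) ^ (n + 1) ∣ E (fun j => PowerSeries.X * b j) 1 -
        E (fun j => PowerSeries.X * b' j) 1 := by
      refine dvd_E_sub_E (fun j => ?_) 1
      rw [← mul_sub, pow_succ']
      exact mul_dvd_mul_left _ (h j)
    have h2 : (PowerSeries.X : K⟦X⟧) ^ (n + 1) ∣ PowerSeries.X * (b i - b' i) := by
      rw [pow_succ']; exact mul_dvd_mul_left _ (h i)
    have h3 := dvd_sub
      (h1.mul_left (x' * a i * (E (fun j => PowerSeries.X * b j) 1 +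
        E (fun j => PowerSeries.X * b' j) 1))) (h2.mul_left (b i + b' i))
    convert h3 using 1
    ring)
  refine ⟨fun i => PowerSeries.X * Y i, ?_, fun i => ?_⟩
  · rw [PowerSeries.isUnit_iff_constantCoeff, E, map_prod]
    simp
  · have := congrFun hY i
    linear_combination PowerSeries.X * this

variable [IsDomain K]

/-- Modulo `u` the equation is `yᵢ (1 + yᵢ) = 0`; invertibility of `E(y)` excludes the root `-1`. -/
theorem constantCoeff_solution (hx : PowerSeries.X ∣ x) {y : ι → K⟦X⟧} (hE : IsUnit (E y 1))
    (hy : ∀ i, x * a i * E y 1 ^ 2 = y i * (1 + y i)) (i : ι) :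
    PowerSeries.constantCoeff (y i) = 0 := by
  have h := congrArg PowerSeries.constantCoeff (hy i)
  rw [map_mul, map_mul, PowerSeries.X_dvd_iff.1 hx, zero_mul, zero_mul, map_mul, eq_comm,
    mul_eq_zero] at h
  refine h.resolve_right fun h => ?_
  rw [PowerSeries.isUnit_iff_constantCoeff, E, map_prod] at hE
  refine hE.ne_zero (Finset.prod_eq_zero (Finset.mem_univ i) ?_)
  rwa [mul_one]

theorem solution_unique (hx : PowerSeries.X ∣ x) {y y' : ι → K⟦X⟧} (hE : IsUnit (E y 1))
    (hy : ∀ i, x * a i * E y 1 ^ 2 = y i * (1 + y i)) (hE' : IsUnit (E y' 1))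
    (hy' : ∀ i, x * a i * E y' 1 ^ 2 = y' i * (1 + y' i)) : y = y' := by
  have h0 := constantCoeff_solution hx hE hy
  have h0' := constantCoeff_solution hx hE' hy'
  have key : ∀ n i, (PowerSeries.X : K⟦X⟧) ^ n ∣ y i - y' i := by
    intro n
    induction n with
    | zero => simp
    | succ n ih =>
      intro i
      -- Subtracting the two equations gives `(yᵢ - yᵢ')(1 + yᵢ + yᵢ')` on one side and a multiple
      -- of `x` on the other.
      have hu : IsUnit (1 + y i + y' i) := by
        rw [PowerSeries.isUnit_iff_constantCoeff]; simp [h0, h0']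
      rw [← hu.dvd_mul_right]
      have h1 : (y i - y' i) * (1 + y i + y' i) =
          x * ((E y 1 - E y' 1) * ((E y 1 + E y' 1) * a i)) := by
        linear_combination hy' i - hy i
      rw [h1, pow_succ']
      exact mul_dvd_mul hx ((dvd_E_sub_E ih 1).mul_right _)
  exact funext fun i => sub_eq_zero.1 (eq_zero_of_X_pow_dvd fun n => key n i)

end solution

/-! ### Algebraicity -/

section subring

variable {R : Type*} [CommRing R] {S : Subring R}

theorem coeff_mul_mem {φ ψ : R⟦X⟧} (hφ : ∀ k, PowerSeries.coeff k φ ∈ S)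
    (hψ : ∀ k, PowerSeries.coeff k ψ ∈ S) (k : ℕ) : PowerSeries.coeff k (φ * ψ) ∈ S := by
  rw [PowerSeries.coeff_mul]
  exact S.sum_mem fun p _ => S.mul_mem (hφ _) (hψ _)

theorem coeff_C_mem {a : R} (ha : a ∈ S) (k : ℕ) :
    PowerSeries.coeff k (PowerSeries.C a) ∈ S := by
  rw [PowerSeries.coeff_C]; split_ifs
  · exact ha
  · exact S.zero_mem

theorem coeff_one_mem (k : ℕ) : PowerSeries.coeff k (1 : R⟦X⟧) ∈ S := by
  rw [PowerSeries.coeff_one]; split_ifs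
  · exact S.one_mem
  · exact S.zero_mem

theorem coeff_catalan_mem {s : R} (hs : s ∈ S) {c : R⟦X⟧}
    (hc : c = 1 + PowerSeries.X * PowerSeries.C s * c ^ 2) (k : ℕ) :
    PowerSeries.coeff k c ∈ S := by
  induction k using Nat.strong_induction_on with
  | _ k ih =>
    rw [hc, map_add]
    refine S.add_mem (coeff_one_mem k) ?_
    rw [mul_assoc]
    cases k with
    | zero => rw [PowerSeries.coeff_zero_X_mul]; exact S.zero_mem
    | succ k =>
      rw [PowerSeries.coeff_succ_X_mul, PowerSeries.coeff_C_mul, pow_two, PowerSeries.coeff_mul]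
      refine S.mul_mem hs (S.sum_mem fun p hp => ?_)
      have := Finset.HasAntidiagonal.mem_antidiagonal.1 hp
      exact S.mul_mem (ih _ (by omega)) (ih _ (by omega))

/-- The hypothesis `hS` is closure under exact division, which power series division uses once per
coefficient, by the constant term of `φ`. -/
theorem coeff_mem_of_mul_mem
    (hS : ∀ a b : R, a ≠ 0 → a ∈ S → a * b ∈ S → b ∈ S) {φ ψ : R⟦X⟧}
    (h0 : PowerSeries.constantCoeff φ ≠ 0) (hφ : ∀ k, PowerSeries.coeff k φ ∈ S)
    (h : ∀ k, PowerSeries.coeff k (ψ * φ) ∈ S) (k : ℕ) : PowerSeries.coeff k ψ ∈ S := by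
  induction k using Nat.strong_induction_on with
  | _ k ih =>
    have h1 := h k
    rw [PowerSeries.coeff_mul, Finset.Nat.sum_antidiagonal_eq_sum_range_succ
      (fun i j => PowerSeries.coeff i ψ * PowerSeries.coeff j φ), Finset.sum_range_succ,
      Nat.sub_self] at h1
    have h2 : ∑ i ∈ Finset.range k, PowerSeries.coeff i ψ * PowerSeries.coeff (k - i) φ ∈ S :=
      S.sum_mem fun i hi => S.mul_mem (ih i (Finset.mem_range.1 hi)) (hφ _)
    have h3 := S.sub_mem h1 h2
    rw [add_sub_cancel_left, mul_comm] at h3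
    rw [PowerSeries.coeff_zero_eq_constantCoeff_apply] at h3
    exact hS _ _ h0 (PowerSeries.coeff_zero_eq_constantCoeff_apply φ ▸ hφ 0) h3

theorem coeff_closed_form_mem {ι : Type*} [Fintype ι]
    (hS : ∀ a b : R, a ≠ 0 → a ∈ S → a * b ∈ S → b ∈ S) {s : R} (hs : s ∈ S) {y : ι → R}
    (hy : ∀ i, y i ∈ S) (hE : E y 1 ≠ 0) {c G : R⟦X⟧}
    (hc : c = 1 + PowerSeries.X * PowerSeries.C s * c ^ 2)
    (hG : G * E (fun i => PowerSeries.C (y i)) c = c * PowerSeries.C (E y 1)) (k : ℕ) :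
    PowerSeries.coeff k G ∈ S := by
  have hcS := coeff_catalan_mem hs hc
  have hE1 : E y 1 ∈ S := S.prod_mem fun i _ => S.add_mem S.one_mem (S.mul_mem (hy i) S.one_mem)
  refine coeff_mem_of_mul_mem hS (φ := E (fun i => PowerSeries.C (y i)) c) ?_ ?_ ?_ k
  · rwa [constantCoeff_E y (constantCoeff_of_catalan_eq (by simp) hc)]
  · refine Finset.prod_induction _ (fun φ : R⟦X⟧ => ∀ k, PowerSeries.coeff k φ ∈ S)
      (fun _ _ => coeff_mul_mem) coeff_one_mem fun i _ k => ?_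
    rw [map_add]
    exact S.add_mem (coeff_one_mem k) (coeff_mul_mem (coeff_C_mem (hy i)) hcS k)
  · rw [hG]; exact coeff_mul_mem hcS (coeff_C_mem hE1)

end subring

theorem isAlgebraic_of_quadratic {A B : Type*} [CommRing A] [Nontrivial A] [CommRing B]
    [Algebra A B] {y : B} {a : A} (h : algebraMap A B a = y * (1 + y)) : IsAlgebraic A y := by
  refine ⟨Polynomial.X ^ 2 + Polynomial.X - Polynomial.C a, ?_, ?_⟩
  · intro h0
    have := congrArg (fun p => Polynomial.coeff p 2) h0
    simp [Polynomial.coeff_X] at this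
  · simp [h]; ring

/-- If `u` is algebraic over `R[s]`, then everything algebraic over `R[s]` is algebraic over
`R[u]`. -/
theorem isAlgebraic_polynomial_of_exchange {R : Type*} [CommRing R] [IsDomain R] {s a : R⟦X⟧}
    (hX : IsAlgebraic (Algebra.adjoin R {s}) (PowerSeries.X : R⟦X⟧))
    (ha : IsAlgebraic (Algebra.adjoin R {s}) a) : IsAlgebraic (Polynomial R) a := by
  have hinj : Function.Injective (algebraMap R R⟦X⟧) := PowerSeries.C_injective
  have : FaithfulSMul R R⟦X⟧ := (faithfulSMul_iff_algebraMap_injective R _).2 hinj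
  have haeval : ∀ p : Polynomial R,
      Polynomial.aeval (PowerSeries.X : R⟦X⟧) p = (p : R⟦X⟧) := by
    intro p
    induction p using Polynomial.induction_on' with
    | add p q hp hq => rw [map_add, hp, hq, Polynomial.coe_add]
    | monomial n b =>
      rw [Polynomial.aeval_monomial, ← Polynomial.C_mul_X_pow_eq_monomial, Polynomial.coe_mul,
        Polynomial.coe_pow, Polynomial.coe_C, Polynomial.coe_X]
      rfl
  have htr : Transcendental R (PowerSeries.X : R⟦X⟧) := by
    rw [transcendental_iff_injective]
    intro p q h
    rw [haeval, haeval] at h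
    exact Polynomial.coe_injective R h
  have hmem : ∀ (t : Set R⟦X⟧) (b : R⟦X⟧), b ∈ (AlgebraicIndependent.matroid R R⟦X⟧).closure t ↔
      IsAlgebraic (Algebra.adjoin R t) b := by
    intro t b
    rw [AlgebraicIndependent.matroid_closure_eq]; rfl
  have h1 : (PowerSeries.X : R⟦X⟧) ∉ (AlgebraicIndependent.matroid R R⟦X⟧).closure ∅ := by
    rw [hmem, Algebra.adjoin_empty, Subalgebra.isAlgebraic_bot_iff hinj]
    exact htr
  have h2 : s ∈ (AlgebraicIndependent.matroid R R⟦X⟧).closure {PowerSeries.X} := by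
    -- Exchange: `u` is algebraic over `R[s]` but not over `R`, hence `s` is algebraic over `R[u]`.
    have := Matroid.mem_closure_insert (X := ∅) h1
      (f := s) (by rw [insert_empty_eq]; exact (hmem _ _).2 hX)
    rwa [insert_empty_eq] at this
  have h3 : IsAlgebraic (Algebra.adjoin R {(PowerSeries.X : R⟦X⟧)}) a := by
    refine IsAlgebraic.adjoin_of_forall_isAlgebraic (s := {s}) ?_ ha
    rintro b ⟨rfl, -⟩
    exact (hmem _ _).1 h2
  let φ : Polynomial R →+* Algebra.adjoin R {(PowerSeries.X : R⟦X⟧)} :=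
    ((Polynomial.aeval (PowerSeries.X : R⟦X⟧)).codRestrict _ fun p => by
      rw [Algebra.adjoin_singleton_eq_range_aeval]; exact ⟨p, rfl⟩).toRingHom
  refine IsAlgebraic.of_ringHom_of_comp_eq φ (RingHom.id R⟦X⟧) h3 ?_
    Function.injective_id ?_
  · rintro ⟨b, hb⟩
    rw [Algebra.adjoin_singleton_eq_range_aeval] at hb
    obtain ⟨p, hp⟩ := hb
    exact ⟨p, Subtype.ext hp⟩
  · refine RingHom.ext fun p => ?_
    exact (haeval p).trans (by simp [PowerSeries.algebraMap_apply'])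

/-! ### The results for the series of sortable tuples -/

section main

variable {r l : ℕ} {lam : Fin (l + 1) → ℕ}

theorem X_dvd_xSub : PowerSeries.X ∣ xSub r lam := Dvd.intro _ rfl

theorem prod_f_ne_zero : ∏ i : Fin l, f r lam 0 i.succ ≠ 0 := by
  refine Finset.prod_ne_zero_iff.2 fun i _ h => ?_
  have := constantCoeff_f_zero (r := r) (lam := lam) i.succ
  rw [h, map_zero] at this
  exact zero_ne_one this

theorem xSub_ne_zero : xSub r lam ≠ 0 := mul_ne_zero PowerSeries.X_ne_zero prod_f_ne_zero

theorem exists_isSolution : ∃ y, IsSolution r lam y := exists_solution X_dvd_xSub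

theorem IsSolution.unique {y y' : block r lam 0 → (Coef r)⟦X⟧} (h : IsSolution r lam y)
    (h' : IsSolution r lam y') : y = y' := solution_unique X_dvd_xSub h.1 h.2 h'.1 h'.2

theorem constantCoeff_tSub (y : block r lam 0 → (Coef r)⟦X⟧) :
    PowerSeries.constantCoeff (tSub r lam y) = 0 := by simp [tSub]

theorem IsSolution.isUnit_E_cat {y : block r lam 0 → (Coef r)⟦X⟧} (h : IsSolution r lam y) :
    IsUnit (E (fun i => PowerSeries.C (y i)) (cat (tSub r lam y))) := by
  rw [PowerSeries.isUnit_iff_constantCoeff, constantCoeff_E y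
    (constantCoeff_of_catalan_eq (constantCoeff_tSub y) (cat_eq (constantCoeff_tSub y)))]
  exact h.1

/-- The candidate `c(t) E(y) / E(y, c(t))`, together with the series extracted from it as `F₀` is
from `G`, solves the functional equation, so uniqueness identifies both. -/
theorem IsSolution.closed_form (hmono : StrictMono lam) (hlast : lam (Fin.last l) = r)
    (hr : 0 < r) {y : block r lam 0 → (Coef r)⟦X⟧} (h : IsSolution r lam y) :
    G r lam * E (fun i => PowerSeries.C (y i)) (cat (tSub r lam y)) =
      cat (tSub r lam y) * PowerSeries.C (E y 1) ∧
    tSub r lam y * F r lam 0 * cat (tSub r lam y) = PowerSeries.C (E y 1) *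
      (PowerSeries.C (E y 1) * cat (tSub r lam y) -
        E (fun i => PowerSeries.C (y i)) (cat (tSub r lam y))) := by
  have hc := cat_eq (constantCoeff_tSub y)
  obtain ⟨v, hv⟩ := h.isUnit_E_cat.exists_left_inv
  set c := cat (tSub r lam y) with hcdef
  set D := E (fun i => PowerSeries.C (y i)) c with hD
  have hG : c * PowerSeries.C (E y 1) * v * D = c * PowerSeries.C (E y 1) := by
    rw [mul_assoc, hv, mul_one]
  obtain ⟨h1, h2⟩ := StackSort.closed_form xSub_ne_zero h.1 h.2 hc hG
    (F := PowerSeries.mk fun k => PowerSeries.coeff (Fintype.card (block r lam 0) + k)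
      (c * PowerSeries.C (E y 1) * v * ∏ i : block r lam 0,
        (PowerSeries.X + PowerSeries.C (PowerSeries.C (MvPolynomial.X i.1)))))
    (fun k => PowerSeries.coeff_mk _ _)
  have hGG := functional_equation_unique X_dvd_xSub (G_eq hmono hlast hr) h2 coeff_F
    (fun k => PowerSeries.coeff_mk _ _)
  have hFF : F r lam 0 = PowerSeries.mk fun k =>
      PowerSeries.coeff (Fintype.card (block r lam 0) + k)
        (c * PowerSeries.C (E y 1) * v * ∏ i : block r lam 0,
          (PowerSeries.X + PowerSeries.C (PowerSeries.C (MvPolynomial.X i.1)))) := by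
    ext1 k
    rw [coeff_F, hGG, PowerSeries.coeff_mk]
  refine ⟨by rw [hGG, hG], ?_⟩
  rw [hFF]
  exact h1

/-- Over the base `A`, generated by `s = x E(y)²`, the series `c(t)` has coefficients in `A`,
although `x` itself is built from the unknown series `f_{0,i}`. Only afterwards is `s` traded for
`u`. -/
theorem isAlgebraic_g (hmono : StrictMono lam) (hlast : lam (Fin.last l) = r) (hr : 0 < r)
    (k : ℕ) : IsAlgebraic (Polynomial (Coef r)) (g r lam k) := by
  obtain ⟨y, h⟩ := exists_isSolution (r := r) (lam := lam)
  set s := xSub r lam * E y 1 ^ 2 with hs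
  set A := Algebra.adjoin (Coef r) {s}
  set S : Subring (Coef r)⟦X⟧ := (Subalgebra.algebraicClosure A (Coef r)⟦X⟧).toSubring
  have hcancel : ∀ a b : (Coef r)⟦X⟧, a ≠ 0 → a ∈ S → a * b ∈ S → b ∈ S := by
    intro a b ha haS hab
    exact IsAlgebraic.of_mul (mem_nonZeroDivisors_of_ne_zero ha) haS hab
  have hAS : ∀ a ∈ A, a ∈ S := fun a ha => isAlgebraic_algebraMap (⟨a, ha⟩ : A)
  have hsA : s ∈ A := Algebra.self_mem_adjoin_singleton _ _
  have hCA : ∀ b : Coef r, PowerSeries.C b ∈ A := fun b => A.algebraMap_mem b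
  have hyS : ∀ i, y i ∈ S := by
    intro i
    refine isAlgebraic_of_quadratic (a := ⟨s * PowerSeries.C (MvPolynomial.X i.1),
      A.mul_mem hsA (hCA _)⟩) ?_
    rw [← h.2 i]
    change s * PowerSeries.C (MvPolynomial.X i.1) = _
    rw [hs]; ring
  have hE1 : E y 1 ∈ S :=
    S.prod_mem fun i _ => S.add_mem S.one_mem (S.mul_mem (hyS i) S.one_mem)
  have hgS : ∀ k, g r lam k ∈ S := by
    intro k
    have := coeff_closed_form_mem hcancel (hAS s hsA) hyS h.1.ne_zero
      (cat_eq (constantCoeff_tSub y)) (h.closed_form hmono hlast hr).1 k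
    rwa [G, PowerSeries.coeff_mk] at this
  have hfS : ∀ i, f r lam 0 i ∈ S := by
    intro i
    rw [f_eq_sum]
    exact S.sum_mem fun j _ => S.mul_mem (hgS _) (hAS _ (hCA _))
  have hXS : (PowerSeries.X : (Coef r)⟦X⟧) ∈ S := by
    -- `u` is the quotient of `s` by `∏ f_{0,i} E(y)²`, both algebraic over `A`.
    refine hcancel ((∏ i : Fin l, f r lam 0 i.succ) * E y 1 ^ 2) _
      (mul_ne_zero prod_f_ne_zero (pow_ne_zero _ h.1.ne_zero))
      (S.mul_mem (S.prod_mem fun i _ => hfS _) (S.pow_mem hE1 2)) ?_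
    have : (∏ i : Fin l, f r lam 0 i.succ) * E y 1 ^ 2 * PowerSeries.X = s := by
      rw [hs, xSub]; ring
    rw [this]
    exact hAS s hsA
  exact isAlgebraic_polynomial_of_exchange hXS (hgS k)

end main

end StackSort

theorem mainTheorem11 (r l : ℕ) (lam : Fin (l + 1) → ℕ) (hpos : 0 < lam 0)
    (hmono : StrictMono lam) (hlast : lam (Fin.last l) = r) :
    (∃! y : StackSort.block r lam 0 → (StackSort.Coef r)⟦X⟧, StackSort.IsSolution r lam y) ∧
    (∀ y : StackSort.block r lam 0 → (StackSort.Coef r)⟦X⟧, StackSort.IsSolution r lam y →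
      let t := StackSort.tSub r lam y
      let c := StackSort.cat t
      let Ey := PowerSeries.C (StackSort.E y 1)
      let Eyc := StackSort.E (fun i => PowerSeries.C (y i)) c
      t ≠ 0 ∧ IsUnit c ∧ IsUnit Eyc ∧
      -- `G = c(t) E(y) / E(y, c(t))`
      StackSort.G r lam * Eyc = c * Ey ∧
      -- `F₀ = (E(y) / t) (E(y) - E(y, c(t)) / c(t))`
      t * StackSort.F r lam 0 * c = Ey * (Ey * c - Eyc)) ∧
    -- every `g_k` is algebraic over `ℚ(u, x₀, …, xᵣ)`
    (∀ k, IsAlgebraic (Polynomial (MvPolynomial (Fin (r + 1)) ℚ)) (StackSort.g r lam k)) := by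
  have hr : 0 < r := lt_of_lt_of_le hpos (StackSort.le_last hmono hlast 0)
  refine ⟨?_, fun y hy => ?_, fun k => StackSort.isAlgebraic_g hmono hlast hr k⟩
  · obtain ⟨y, hy⟩ := StackSort.exists_isSolution (r := r) (lam := lam)
    exact ⟨y, hy, fun y' hy' => hy'.unique hy⟩
  · obtain ⟨hG, hF⟩ := hy.closed_form hmono hlast hr
    refine ⟨?_, ?_, hy.isUnit_E_cat, hG, hF⟩
    · refine mul_ne_zero PowerSeries.X_ne_zero fun h => ?_
      exact mul_ne_zero StackSort.xSub_ne_zero (pow_ne_zero 2 hy.1.ne_zero)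
        (PowerSeries.C_injective (h.trans (map_zero _).symm))
    · rw [PowerSeries.isUnit_iff_constantCoeff, StackSort.constantCoeff_of_catalan_eq
        (StackSort.constantCoeff_tSub y) (StackSort.cat_eq (StackSort.constantCoeff_tSub y))]
      exact isUnit_one
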